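/- Let $\mathcal H_A,\mathcal H_B$ be finite-dimensional Hilbert spaces and let $H=H_0+V_{AB}$ on $\mathcal H_A\otimes\mathcal H_B$, where $H_0=H_A\otimes 1+1\otimes H_B$ and $H_A,H_B,V_{AB}$ are Hermitian. Write $\|\cdot\|$ for the operator norm and, for $1\le p<\infty$, $\|O\|_p=[\mathrm{tr}(|O|^p)]^{1/p}$ with $|O|=\sqrt{O^\dagger O}$, and $\|O\|_\infty=\|O\|$. For an operator $O$ on $\mathcal H_A\otimes\mathcal H_B$, let $\mathrm{SR}(O)$ be the least integer $r$ such that $O=\sum_{m=1}^{r}O_{A,m}\otimes O_{B,m}$ for some operators $O_{A,m}$ on $\mathcal H_A$ and $O_{B,m}$ on $\mathcal H_B$. Put $\mathrm{ad}_{H_0}(X)=H_0X-XH_0$. Suppose that $V_{AB}=\sum_{j=1}^\infty V_j$ with $\tilde g:=\sum_{j=1}^\infty\|V_j\|<\infty$ and $\mathrm{SR}(V_j)\le D_0$ for all $j$, where $D_0\ge 1$ is an integer, and that there are constants $C_0\ge 1$ and $\kappa>0$ with $$\sum_{j\ge D+1}\|V_j\|\le C_0\,\tilde g\,(D+1)^{-\kappa}\qquad\text{for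 all integers } D\ge 0 .$$ Suppose further that $\mathcal Q\ge 0$ satisfies $$\frac1{s!}\big\|\mathrm{ad}_{H_0}^s(V_j)\big\|\le \mathcal Q^s\|V_j\|\qquad\text{for all } j\ge 1 \text{ and all integers } s\ge 0 ,$$ and set $$\mathcal Q_0:=\Big[\min\Big(\frac1{4\mathcal Q},\frac1{4eC_0\tilde g}\Big)\Big]^{-1}=\max(4\mathcal Q,\,4eC_0\tilde g)$$ (with $1/0=\infty$, $1/\infty=0$). Let $\epsilon_0>0$, and let $0^0=1$. Then: 1. For every $t\ge 0$ there is an operator $\tilde U_t$ with $\|e^{-iHt}-\tilde U_t\|\le\epsilon_0$ and $$\mathrm{SR}(\tilde U_t)\le\Big(\frac{8\lceil t\mathcal Q_0\rceil}{\epsilon_0}\Big)^{[6+4/\kappa+\log_2 D_0]\,\lceil t\mathcal Q_0\rceil}.$$ 2. For every $\beta\ge 0$ there is an operator $\tilde\rho_\beta$ such that $\|e^{\beta H}-\tilde\rho_\beta\|_p\le\epsilon_0\|e^{\beta H}\|_p$ for all $p\in[1,\infty]$ simultaneously, and $$\mathrm{SR}(\tilde\rho_\beta)\le\Big(\frac{48\lceil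 \beta\mathcal Q_0\rceil}{\epsilon_0}\Big)^{2[6+4/\kappa+\log_2 D_0]\,\lceil \beta\mathcal Q_0\rceil}.$$ -/

import Mathlib

open scoped Kronecker Matrix.Norms.L2Operator MatrixOrder ENNReal

noncomputable section

/-- Sums of `r` product operators on the bipartite space `ℂ^a ⊗ ℂ^b = ℂ^(a × b)`. -/
def IsSumOfProducts {a b : Type*} (O : Matrix (a × b) (a × b) ℂ) (r : ℕ) : Prop :=
  ∃ (X : Fin r → Matrix a a ℂ) (Y : Fin r → Matrix b b ℂ), O = ∑ m, X m ⊗ₖ Y m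

/-- The operator Schmidt rank across the cut `a | b`: the minimal number of product operators
that sum to `O`. -/
def schmidtRank {a b : Type*} (O : Matrix (a × b) (a × b) ℂ) : ℕ :=
  sInf {r : ℕ | IsSumOfProducts O r}

/-- Every operator is a finite sum of product operators, so the minimum defining `schmidtRank`
is attained. -/
theorem isSumOfProducts_schmidtRank {a b : Type*} [Fintype a] [Fintype b]
    (O : Matrix (a × b) (a × b) ℂ) : IsSumOfProducts O (schmidtRank O) := by
  classical
  refine Nat.sInf_mem (s := {r : ℕ | IsSumOfProducts O r}) ⟨Fintype.card (a × a), ?_⟩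
  let e := (Fintype.equivFin (a × a)).symm
  refine ⟨fun m => Matrix.single (e m).1 (e m).2 1,
    fun m => Matrix.of fun k l => O ((e m).1, k) ((e m).2, l), ?_⟩
  ext ⟨i, k⟩ ⟨j, l⟩
  rw [Matrix.sum_apply, Equiv.sum_comp e (fun x : a × a =>
    (Matrix.single x.1 x.2 (1 : ℂ) ⊗ₖ Matrix.of fun k l => O (x.1, k) (x.2, l)) (i, k) (j, l)),
    Finset.sum_eq_single (i, j)]
  · simp
  · rintro ⟨i', j'⟩ - hne
    rw [Matrix.kroneckerMap_apply, Matrix.single_apply, if_neg, zero_mul]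
    rintro ⟨rfl, rfl⟩
    exact hne rfl
  · simp

/-- The Schatten `p`-norm `(tr |O|^p)^(1/p)`, where `|O| = √(O†O)`; for `p = ∞` it is the
operator norm (`‖·‖` is the operator norm on `ℂ^n` with its Euclidean norm). -/
def schattenNorm {n : Type*} [Fintype n] [DecidableEq n] (p : ℝ≥0∞) (O : Matrix n n ℂ) : ℝ :=
  if p = ∞ then ‖O‖
  else ((CFC.rpow (CFC.abs O) p.toReal).trace.re) ^ (1 / p.toReal)

/-- The decoupled Hamiltonian `H₀ = H_A ⊗ 1 + 1 ⊗ H_B`. -/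
def decoupledHamiltonian {a b : Type*} [DecidableEq a] [DecidableEq b]
    (HA : Matrix a a ℂ) (HB : Matrix b b ℂ) : Matrix (a × b) (a × b) ℂ :=
  HA ⊗ₖ (1 : Matrix b b ℂ) + (1 : Matrix a a ℂ) ⊗ₖ HB

/-- The iterated commutator `ad_H^s (X)`, where `ad_H (Y) = [H, Y] = H Y - Y H`. -/
def iteratedCommutator {n : Type*} [Fintype n] (H : Matrix n n ℂ) (s : ℕ) (X : Matrix n n ℂ) :
    Matrix n n ℂ :=
  (fun Y => H * Y - Y * H)^[s] X

/-- The rate `𝒬₀ = (min {1/(4𝒬), 1/(4 e C₀ g)})⁻¹`, written as a maximum so that `𝒬 = 0` and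
`g = 0` get the value intended by `1/0 = ∞`. -/
def rateQ0 (Q C₀ g : ℝ) : ℝ := max (4 * Q) (4 * Real.exp 1 * C₀ * g)

theorem rateQ0_eq {Q C₀ g : ℝ} (hQ : 0 < Q) (hC : 0 < C₀) (hg : 0 < g) :
    rateQ0 Q C₀ g = (min (1 / (4 * Q)) (1 / (4 * Real.exp 1 * C₀ * g)))⁻¹ := by
  have h1 : 0 < 4 * Q := by positivity
  have h2 : 0 < 4 * Real.exp 1 * C₀ * g := by positivity
  unfold rateQ0
  rcases le_total (4 * Q) (4 * Real.exp 1 * C₀ * g) with h | h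
  · rw [max_eq_right h, min_eq_right (one_div_le_one_div_of_le h1 h), one_div, inv_inv]
  · rw [max_eq_left h, min_eq_left (one_div_le_one_div_of_le h2 h), one_div, inv_inv]

end

/-!
The evolution is cut into `n = ⌈t 𝒬₀⌉` steps of complex time `x` with `|x| 𝒬₀ ≤ 1`. One step is
`exp (x H) = exp (x H₀) * F`, where `exp (x H₀)` is a product operator and the propagator
`F = exp (-x H₀) * exp (x H)` of the interaction picture has a Dyson expansion. Expanding the
interaction picture in commutators, `F` is a sum over words in the letters `(s, j)`: each letter
stands for `x ^ (s + 1) * ad ^ s (V j) / s!`, up to a sign, and each word carries a coefficient of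
modulus at most `1` (`tsum_dysonTerm`). The commutator with `H₀ = H_A ⊗ 1 + 1 ⊗ H_B` multiplies the
Schmidt rank of `V j` by at most `s + 1`.

Give the letter `(s, j)` the weight `2 ^ (s + 1) * (j + 1) ^ (κ / 2)` and a word the product of the
weights of its letters. By the choice of `𝒬₀` and the decay of the tails of `∑ ‖V j‖`, the Dyson
expansion multiplied by the weights is still bounded by `4` in norm (`dysonTerm_weighted`). Hence
discarding all words of weight above `N` changes `F` by at most `4 / N`. The words that remain have
at most `log₂ N` letters, which accounts for the factor `N ^ log₂ D₀`, and Rankin's trick counts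
them by a power `N ^ (5 + 4 / κ)` (`prod_succ_le_of_wordWeight_le`). With `N` a multiple of `n / ε₀`
this is the claimed rank of a single step (`exists_truncated_propagator`).

It remains to add up the errors. Writing the approximate step as `K (1 + E)` with `K = exp (x H)`,
the error of the whole evolution is a sum of words `K C₁ ⋯ K C_n` in which each `C i` is `1 + E`,
`E` or `1`. In real time `K` is unitary and the operator norm suffices. In imaginary time `K` is
positive, and every such word is bounded in the Schatten norm by `‖K ^ n‖_p` times the operator norms
of the `C i` (`schattenNorm_sum_prod_le`). This follows by duality from Hölder's inequality for
traces of products (`norm_trace_prod_spectralPow_le`): the tuples of exponents for which that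
inequality holds form a convex set by Hadamard's three lines theorem, and contain the vertices of the
simplex.
-/

/-! ### Calculus of the operator Schmidt rank -/

section SchmidtRank

variable {a b : Type*}

theorem IsSumOfProducts.schmidtRank_le {O : Matrix (a × b) (a × b) ℂ} {r : ℕ}
    (h : IsSumOfProducts O r) : schmidtRank O ≤ r :=
  Nat.sInf_le h

theorem schmidtRank_zero : schmidtRank (0 : Matrix (a × b) (a × b) ℂ) = 0 :=
  Nat.le_zero.1 (IsSumOfProducts.schmidtRank_le ⟨Fin.elim0, Fin.elim0, by simp⟩)

theorem schmidtRank_kronecker_le (X : Matrix a a ℂ) (Y : Matrix b b ℂ) :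
    schmidtRank (X ⊗ₖ Y) ≤ 1 :=
  IsSumOfProducts.schmidtRank_le ⟨fun _ => X, fun _ => Y, by simp⟩

theorem schmidtRank_one_le [DecidableEq a] [DecidableEq b] :
    schmidtRank (1 : Matrix (a × b) (a × b) ℂ) ≤ 1 := by
  rw [← Matrix.one_kronecker_one]
  exact schmidtRank_kronecker_le _ _

variable [Fintype a] [Fintype b]

theorem schmidtRank_add_le (O P : Matrix (a × b) (a × b) ℂ) :
    schmidtRank (O + P) ≤ schmidtRank O + schmidtRank P := by
  obtain ⟨X, Y, h⟩ := isSumOfProducts_schmidtRank O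
  obtain ⟨X', Y', h'⟩ := isSumOfProducts_schmidtRank P
  refine IsSumOfProducts.schmidtRank_le ⟨Fin.append X X', Fin.append Y Y', ?_⟩
  conv_lhs => rw [h, h']
  simp [Fin.sum_univ_add]

theorem schmidtRank_sum_le {ι : Type*} (s : Finset ι) (O : ι → Matrix (a × b) (a × b) ℂ) :
    schmidtRank (∑ i ∈ s, O i) ≤ ∑ i ∈ s, schmidtRank (O i) :=
  Finset.le_sum_of_subadditive schmidtRank schmidtRank_zero.le schmidtRank_add_le s O

theorem schmidtRank_smul_le (c : ℂ) (O : Matrix (a × b) (a × b) ℂ) :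
    schmidtRank (c • O) ≤ schmidtRank O := by
  obtain ⟨X, Y, h⟩ := isSumOfProducts_schmidtRank O
  refine IsSumOfProducts.schmidtRank_le ⟨fun i => c • X i, Y, ?_⟩
  conv_lhs => rw [h]
  simp [Finset.smul_sum, Matrix.smul_kronecker]

theorem schmidtRank_mul_le (O P : Matrix (a × b) (a × b) ℂ) :
    schmidtRank (O * P) ≤ schmidtRank O * schmidtRank P := by
  obtain ⟨X, Y, h⟩ := isSumOfProducts_schmidtRank O
  obtain ⟨X', Y', h'⟩ := isSumOfProducts_schmidtRank P
  refine IsSumOfProducts.schmidtRank_le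
    ⟨fun i => X (finProdFinEquiv.symm i).1 * X' (finProdFinEquiv.symm i).2,
      fun i => Y (finProdFinEquiv.symm i).1 * Y' (finProdFinEquiv.symm i).2, ?_⟩
  conv_lhs => rw [h, h']
  rw [Equiv.sum_comp finProdFinEquiv.symm
    (fun p => (X p.1 * X' p.2) ⊗ₖ (Y p.1 * Y' p.2)), Fintype.sum_prod_type]
  simp [Finset.sum_mul_sum, Matrix.mul_kronecker_mul]

theorem iteratedCommutator_succ (H : Matrix a a ℂ) (s : ℕ) (X : Matrix a a ℂ) :
    iteratedCommutator H (s + 1) X =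
      H * iteratedCommutator H s X - iteratedCommutator H s X * H :=
  Function.iterate_succ_apply' _ _ _

theorem iteratedCommutator_sum (H : Matrix a a ℂ) (s : ℕ) {ι : Type*} (t : Finset ι)
    (X : ι → Matrix a a ℂ) :
    iteratedCommutator H s (∑ i ∈ t, X i) = ∑ i ∈ t, iteratedCommutator H s (X i) := by
  induction s with
  | zero => rfl
  | succ s ih =>
    simp only [iteratedCommutator_succ, ih, Finset.mul_sum, Finset.sum_mul,
      Finset.sum_sub_distrib]

variable [DecidableEq a] [DecidableEq b]

theorem schmidtRank_pow_le (O : Matrix (a × b) (a × b) ℂ) (n : ℕ) :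
    schmidtRank (O ^ n) ≤ schmidtRank O ^ n := by
  induction n with
  | zero => simpa using schmidtRank_one_le
  | succ n ih =>
    rw [pow_succ, pow_succ]
    exact (schmidtRank_mul_le _ _).trans (Nat.mul_le_mul_right _ ih)

theorem exp_kronecker_one (X : Matrix a a ℂ) :
    NormedSpace.exp (X ⊗ₖ (1 : Matrix b b ℂ)) = NormedSpace.exp X ⊗ₖ (1 : Matrix b b ℂ) := by
  let f : Matrix a a ℂ →+* Matrix (a × b) (a × b) ℂ :=
    { toFun := fun X => X ⊗ₖ 1
      map_one' := Matrix.one_kronecker_one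
      map_mul' := fun X Y => by simp [← Matrix.mul_kronecker_mul]
      map_zero' := by simp
      map_add' := fun X Y => by simp [Matrix.add_kronecker] }
  have hf : Continuous f := by
    refine continuous_matrix fun i j => ?_
    simp only [f, RingHom.coe_mk, MonoidHom.coe_mk, OneHom.coe_mk, Matrix.kroneckerMap_apply]
    fun_prop
  let _ : NormedAlgebra ℚ (Matrix a a ℂ) := NormedAlgebra.restrictScalars ℚ ℂ _
  exact (NormedSpace.map_exp f hf X).symm

theorem exp_one_kronecker (Y : Matrix b b ℂ) :
    NormedSpace.exp ((1 : Matrix a a ℂ) ⊗ₖ Y) = (1 : Matrix a a ℂ) ⊗ₖ NormedSpace.exp Y := by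
  let f : Matrix b b ℂ →+* Matrix (a × b) (a × b) ℂ :=
    { toFun := fun X => 1 ⊗ₖ X
      map_one' := Matrix.one_kronecker_one
      map_mul' := fun X Y => by simp [← Matrix.mul_kronecker_mul]
      map_zero' := by simp
      map_add' := fun X Y => by simp [Matrix.kronecker_add] }
  have hf : Continuous f := by
    refine continuous_matrix fun i j => ?_
    simp only [f, RingHom.coe_mk, MonoidHom.coe_mk, OneHom.coe_mk, Matrix.kroneckerMap_apply]
    fun_prop
  let _ : NormedAlgebra ℚ (Matrix b b ℂ) := NormedAlgebra.restrictScalars ℚ ℂ _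
  exact (NormedSpace.map_exp f hf Y).symm

/-- The two halves of a decoupled Hamiltonian commute, so its exponential is a product operator. -/
theorem schmidtRank_exp_decoupledHamiltonian_le (HA : Matrix a a ℂ) (HB : Matrix b b ℂ) (x : ℂ) :
    schmidtRank (NormedSpace.exp (x • decoupledHamiltonian HA HB)) ≤ 1 := by
  have hc : Commute ((x • HA) ⊗ₖ (1 : Matrix b b ℂ)) ((1 : Matrix a a ℂ) ⊗ₖ (x • HB)) := by
    simp [Commute, SemiconjBy, ← Matrix.mul_kronecker_mul]
  rw [decoupledHamiltonian, smul_add, ← Matrix.smul_kronecker, ← Matrix.kronecker_smul,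
    Matrix.exp_add_of_commute _ _ hc, exp_kronecker_one, exp_one_kronecker,
    ← Matrix.mul_kronecker_mul]
  exact schmidtRank_kronecker_le _ _

theorem iteratedCommutator_decoupledHamiltonian_kronecker (HA : Matrix a a ℂ) (HB : Matrix b b ℂ)
    (s : ℕ) (X : Matrix a a ℂ) (Y : Matrix b b ℂ) :
    iteratedCommutator (decoupledHamiltonian HA HB) s (X ⊗ₖ Y) =
      ∑ m ∈ Finset.HasAntidiagonal.antidiagonal s, s.choose m.1 •
        (iteratedCommutator HA m.1 X ⊗ₖ iteratedCommutator HB m.2 Y) := by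
  let KA : Matrix (a × b) (a × b) ℂ := HA ⊗ₖ 1
  let KB : Matrix (a × b) (a × b) ℂ := 1 ⊗ₖ HB
  have hAB : KA * KB = KB * KA := by simp [KA, KB, ← Matrix.mul_kronecker_mul]
  let f : Module.End ℂ (Matrix (a × b) (a × b) ℂ) :=
    LinearMap.mulLeft ℂ KA - LinearMap.mulRight ℂ KA
  let g : Module.End ℂ (Matrix (a × b) (a × b) ℂ) :=
    LinearMap.mulLeft ℂ KB - LinearMap.mulRight ℂ KB
  have hfg : Commute f g := by
    refine LinearMap.ext fun Z => ?_
    have h1 : KA * (KB * Z) = KB * (KA * Z) := by rw [← mul_assoc, hAB, mul_assoc]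
    have h2 : Z * KA * KB = Z * KB * KA := by rw [mul_assoc, hAB, mul_assoc]
    simp only [f, g, Module.End.mul_apply, LinearMap.sub_apply, LinearMap.mulLeft_apply,
      LinearMap.mulRight_apply, mul_sub, sub_mul, h1, h2, mul_assoc]
    simp only [← mul_assoc]
    abel
  have hpow : ∀ (s : ℕ) (Z : Matrix (a × b) (a × b) ℂ),
      iteratedCommutator (decoupledHamiltonian HA HB) s Z = ((f + g) ^ s) Z := by
    intro s Z
    induction s with
    | zero => rfl
    | succ s ih =>
      rw [iteratedCommutator_succ, ih, pow_succ', Module.End.mul_apply]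
      simp only [f, g, decoupledHamiltonian, LinearMap.add_apply, LinearMap.sub_apply,
        LinearMap.mulLeft_apply, LinearMap.mulRight_apply, add_mul, mul_add, KA, KB]
      abel
  have hf : ∀ (i : ℕ) (Y : Matrix b b ℂ), (f ^ i) (X ⊗ₖ Y) = iteratedCommutator HA i X ⊗ₖ Y := by
    intro i Y
    induction i with
    | zero => rfl
    | succ i ih =>
      rw [iteratedCommutator_succ, pow_succ', Module.End.mul_apply, ih]
      ext p q
      simp [f, KA, ← Matrix.mul_kronecker_mul, sub_mul]
  have hg : ∀ i : ℕ, (g ^ i) (X ⊗ₖ Y) = X ⊗ₖ iteratedCommutator HB i Y := by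
    intro i
    induction i with
    | zero => rfl
    | succ i ih =>
      rw [iteratedCommutator_succ, pow_succ', Module.End.mul_apply, ih]
      ext p q
      simp [g, KB, ← Matrix.mul_kronecker_mul, mul_sub]
  rw [hpow, hfg.add_pow', LinearMap.sum_apply]
  refine Finset.sum_congr rfl fun m _ => ?_
  rw [LinearMap.smul_apply, Module.End.mul_apply, hg, hf]

/-- Expanding the binomial `ad_{H₀} ^ s = (ad_{H_A} + ad_{H_B}) ^ s` turns each product operator
into `s + 1` product operators. -/
theorem schmidtRank_iteratedCommutator_le (HA : Matrix a a ℂ) (HB : Matrix b b ℂ)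
    (s : ℕ) (O : Matrix (a × b) (a × b) ℂ) :
    schmidtRank (iteratedCommutator (decoupledHamiltonian HA HB) s O) ≤
      (s + 1) * schmidtRank O := by
  obtain ⟨X, Y, h⟩ := isSumOfProducts_schmidtRank O
  have h1 : ∀ i, schmidtRank (iteratedCommutator (decoupledHamiltonian HA HB) s (X i ⊗ₖ Y i))
      ≤ s + 1 := by
    intro i
    rw [iteratedCommutator_decoupledHamiltonian_kronecker]
    refine (schmidtRank_sum_le _ _).trans ?_
    refine (Finset.sum_le_card_nsmul _ _ 1 fun m _ => ?_).trans (by simp)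
    rw [← Nat.cast_smul_eq_nsmul ℂ]
    exact (schmidtRank_smul_le _ _).trans (schmidtRank_kronecker_le _ _)
  calc _ = schmidtRank (∑ i, iteratedCommutator (decoupledHamiltonian HA HB) s (X i ⊗ₖ Y i)) := by
        rw [← iteratedCommutator_sum, ← h]
    _ ≤ ∑ i, schmidtRank (iteratedCommutator (decoupledHamiltonian HA HB) s (X i ⊗ₖ Y i)) :=
        schmidtRank_sum_le _ _
    _ ≤ ∑ _i : Fin (schmidtRank O), (s + 1) := Finset.sum_le_sum fun i _ => h1 i
    _ = _ := by simp [mul_comm]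

end SchmidtRank

/-! ### Sums over words, and sums against a tail bound -/

/-- A word is empty or consists of a first letter and a word. -/
def listEquivSum (α : Type*) : Unit ⊕ (α × List α) ≃ List α where
  toFun := Sum.elim (fun _ => []) fun p => p.1 :: p.2
  invFun := fun l => match l with
    | [] => .inl ()
    | a :: w => .inr (a, w)
  left_inv := by rintro (_ | ⟨a, w⟩) <;> rfl
  right_inv := by rintro (_ | ⟨a, w⟩) <;> rfl

theorem hasSum_list {α E : Type*} [NormedAddCommGroup E] {f : List α → E} {x : E}
    (h : HasSum (fun p : α × List α => f (p.1 :: p.2)) x) : HasSum f (f [] + x) := by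
  rw [← (listEquivSum α).hasSum_iff]
  exact HasSum.sum (hasSum_unique (f ∘ listEquivSum α ∘ Sum.inl)) h

theorem summable_list_iff {α E : Type*} [NormedAddCommGroup E] [CompleteSpace E] {f : List α → E} :
    Summable f ↔ Summable fun p : α × List α => f (p.1 :: p.2) :=
  ⟨fun h => ((listEquivSum α).summable_iff.2 h).comp_injective Sum.inr_injective,
    fun h => (hasSum_list h.hasSum).summable⟩

theorem tsum_list {α E : Type*} [NormedAddCommGroup E] [CompleteSpace E] {f : List α → E}
    (hf : Summable f) : ∑' w, f w = f [] + ∑' p : α × List α, f (p.1 :: p.2) :=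
  (hasSum_list (summable_list_iff.1 hf).hasSum).tsum_eq

/-- Summing the product of the letter weights over all words gives a geometric series in the total
weight `r` of the letters. -/
theorem summable_list_prod_and_tsum_le {α : Type*} {f : α → ℝ} (hf : ∀ i, 0 ≤ f i) (hs : Summable f) {r : ℝ}
    (hr : ∑' i, f i ≤ r) (hr1 : r < 1) :
    Summable (fun w : List α => (w.map f).prod) ∧
      ∑' w : List α, (w.map f).prod ≤ (1 - r)⁻¹ := by
  have hr0 : 0 ≤ r := (tsum_nonneg hf).trans hr
  have hnn : ∀ w : List α, 0 ≤ (w.map f).prod := fun w =>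
    List.prod_nonneg (by simpa using fun a _ => hf a)
  -- the sum over the words of length less than `n` is at most `1 + r + ⋯ + r ^ (n - 1)`
  have key : ∀ n : ℕ, Summable (fun w : List α => if w.length < n then (w.map f).prod else 0) ∧
      ∑' w : List α, (if w.length < n then (w.map f).prod else 0) ≤ (1 - r)⁻¹ := by
    intro n
    induction n with
    | zero => simpa using (sub_nonneg.2 hr1.le)
    | succ n ih =>
      have hcons : (fun p : α × List α => if (p.1 :: p.2).length < n + 1 then
          ((p.1 :: p.2).map f).prod else 0) =
          fun p => f p.1 * (if p.2.length < n then (p.2.map f).prod else 0) := by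
        funext p
        simp
      have hs' := hs.mul_of_nonneg ih.1 hf fun w => by
        dsimp only
        split_ifs
        exacts [hnn w, le_rfl]
      have hsum : Summable
          (fun w : List α => if w.length < n + 1 then (w.map f).prod else 0) := by
        rw [summable_list_iff, hcons]
        exact hs'
      refine ⟨hsum, ?_⟩
      rw [tsum_list hsum, hcons, ← hs.tsum_mul_tsum ih.1 hs']
      have : (1 - r)⁻¹ = 1 + r * (1 - r)⁻¹ := by
        have : 1 - r ≠ 0 := (sub_pos.2 hr1).ne'
        field_simp
        ring
      rw [this]
      simp only [List.length_nil, Nat.succ_pos, if_true, List.map_nil, List.prod_nil]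
      gcongr
      · exact tsum_nonneg fun w => by split_ifs; exacts [hnn w, le_rfl]
      · exact ih.2
  have hfin : ∀ s : Finset (List α), ∑ w ∈ s, (w.map f).prod ≤ (1 - r)⁻¹ := by
    intro s
    obtain ⟨n, hn⟩ : ∃ n, ∀ w ∈ s, w.length < n :=
      ⟨s.sup List.length + 1, fun w hw => Nat.lt_succ_of_le (Finset.le_sup hw)⟩
    rw [Finset.sum_congr rfl fun w hw => (if_pos (hn w hw)).symm]
    refine ((key n).1.sum_le_tsum s fun w _ => ?_).trans (key n).2
    split_ifs
    exacts [hnn w, le_rfl]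
  have hsumm := summable_of_sum_le hnn hfin
  exact ⟨hsumm, hsumm.tsum_le_of_sum_le hfin⟩

/-- Summation by parts: if the tails of `∑ v j` decay like `(D + 1) ^ (-κ)`, then `∑ v j` still
converges against the growing weight `(j + 1) ^ (κ / 2)`. -/
theorem tsum_mul_rpow_half_le {v : ℕ → ℝ} (hv : ∀ j, 0 ≤ v j) (hs : Summable v) {M κ : ℝ}
    (hM : 0 ≤ M) (hκ : 0 < κ)
    (htail : ∀ D : ℕ, ∑' j, v (D + j) ≤ M * ((D : ℝ) + 1) ^ (-κ)) :
    Summable (fun j : ℕ => v j * ((j : ℝ) + 1) ^ (κ / 2)) ∧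
      ∑' j : ℕ, v j * ((j : ℝ) + 1) ^ (κ / 2) ≤ 2 * M := by
  set u : ℕ → ℝ := fun j => ((j : ℝ) + 1) ^ (κ / 2) with hu
  have hupos : ∀ j, 0 < u j := fun j => by positivity
  have humono : ∀ j, u j ≤ u (j + 1) := fun j => by
    simp only [hu]
    gcongr
    linarith
  have hR : ∀ D, ∑' j, v (D + j) = v D + ∑' j, v (D + 1 + j) := by
    intro D
    have h : Summable fun j => v (D + j) := by
      simpa only [add_comm] using (summable_nat_add_iff D).2 hs
    rw [h.tsum_eq_zero_add]
    simp only [add_zero, add_assoc, add_comm 1]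
  have hRnn : ∀ D, 0 ≤ ∑' j, v (D + j) := fun D => tsum_nonneg fun j => hv _
  have htail' : ∀ D : ℕ, ∑' j, v (D + j) ≤ M * (u D * u D)⁻¹ := by
    intro D
    refine (htail D).trans_eq ?_
    simp only [hu]
    rw [← Real.rpow_add (by positivity), add_halves, Real.rpow_neg (by positivity)]
  have key : ∀ D : ℕ, ∑ j ∈ Finset.range (D + 1), v j * u j + (∑' j, v (D + 1 + j)) * u D ≤
      M * (2 - (u D)⁻¹) := by
    intro D
    induction D with
    | zero =>
      have h0 : u 0 = 1 := by simp [hu]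
      have h1 := hR 0
      have h2 := htail' 0
      simp only [h0, mul_one, inv_one] at h2
      simp only [zero_add, Finset.range_one, Finset.sum_singleton, h0, mul_one, inv_one]
      simp only [zero_add] at h1 h2
      linarith
    | succ D ih =>
      rw [Finset.sum_range_succ]
      have h1 := hR (D + 1)
      have h2 : (∑' j, v (D + 1 + j)) * (u (D + 1) - u D) ≤
          M * ((u D)⁻¹ - (u (D + 1))⁻¹) := by
        have hp := hupos D
        have hq := hupos (D + 1)
        have hm := humono D
        calc (∑' j, v (D + 1 + j)) * (u (D + 1) - u D)
            ≤ M * (u (D + 1) * u (D + 1))⁻¹ * (u (D + 1) - u D) := by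
              exact mul_le_mul_of_nonneg_right (htail' (D + 1)) (by linarith)
          _ ≤ M * (u D * u (D + 1))⁻¹ * (u (D + 1) - u D) := by
              have : 0 ≤ u (D + 1) - u D := by linarith
              gcongr
          _ = M * ((u D)⁻¹ - (u (D + 1))⁻¹) := by
              field_simp
      have h3 := congrArg (· * u (D + 1)) h1
      simp only [add_mul] at h3
      linarith
  have hfin : ∀ n, ∑ j ∈ Finset.range n, v j * u j ≤ 2 * M := by
    intro n
    rcases n with _ | D
    · simpa using hM
    · have h1 := key D
      have h2 := mul_nonneg (hRnn (D + 1)) (hupos D).le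
      have h3 := mul_nonneg hM (inv_nonneg.2 (hupos D).le)
      linarith
  have hnn : ∀ j, 0 ≤ v j * u j := fun j => mul_nonneg (hv j) (hupos j).le
  have hsumm := summable_of_sum_range_le hnn hfin
  exact ⟨hsumm, hsumm.tsum_le_of_sum_range_le hfin⟩

/-! ### The Dyson expansion -/

section Dyson

open Finset.HasAntidiagonal (antidiagonal)

variable {n : Type*} [Fintype n]

theorem iteratedCommutator_neg (H : Matrix n n ℂ) (s : ℕ) (X : Matrix n n ℂ) :
    iteratedCommutator (-H) s X = (-1 : ℂ) ^ s • iteratedCommutator H s X := by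
  induction s with
  | zero => simp [iteratedCommutator]
  | succ s ih =>
    rw [iteratedCommutator_succ, ih, iteratedCommutator_succ, pow_succ]
    simp only [neg_mul, mul_neg, Matrix.mul_smul, Matrix.smul_mul, mul_smul, smul_sub,
      neg_smul, one_smul]

/-- As an operator in `V`, the iterated commutator is continuous. -/
theorem hasSum_iteratedCommutator (H : Matrix n n ℂ) (s : ℕ) {ι : Type*} {V : ι → Matrix n n ℂ}
    {W : Matrix n n ℂ} (h : HasSum V W) :
    HasSum (fun i => iteratedCommutator H s (V i)) (iteratedCommutator H s W) := by
  induction s with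
  | zero => exact h
  | succ s ih =>
    simp only [iteratedCommutator_succ]
    exact (ih.mul_left H).sub (ih.mul_right H)

variable [DecidableEq n]

/-- Moving a power of `X` past `V`: `X ^ i = (ad_X + R_X) ^ i`, where left multiplication by `X`
is the sum of the commuting maps `ad_X` and right multiplication `R_X`. -/
theorem pow_mul_eq_sum_iteratedCommutator (X V : Matrix n n ℂ) (i : ℕ) :
    ((i.factorial : ℂ)⁻¹ • X ^ i) * V = ∑ p ∈ antidiagonal i,
      ((p.1.factorial : ℂ)⁻¹ • iteratedCommutator X p.1 V) *
        ((p.2.factorial : ℂ)⁻¹ • X ^ p.2) := by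
  let l : Module.End ℂ (Matrix n n ℂ) := LinearMap.mulLeft ℂ X
  let r : Module.End ℂ (Matrix n n ℂ) := LinearMap.mulRight ℂ X
  have hlr : Commute l r := LinearMap.commute_mulLeft_right X X
  have hc : Commute (l - r) r := hlr.sub_left (Commute.refl r)
  have had : ∀ s, ((l - r) ^ s) V = iteratedCommutator X s V := by
    intro s
    induction s with
    | zero => rfl
    | succ s ih => rw [pow_succ', Module.End.mul_apply, ih, iteratedCommutator_succ]; rfl
  have h := congrArg (fun f : Module.End ℂ (Matrix n n ℂ) => (i.factorial : ℂ)⁻¹ • f V)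
    (hc.add_pow' i)
  simp only [sub_add_cancel, l, LinearMap.pow_mulLeft, LinearMap.mulLeft_apply] at h
  rw [Matrix.smul_mul, h, LinearMap.sum_apply, Finset.smul_sum]
  refine Finset.sum_congr rfl fun p hp => ?_
  have hp' : p.1 + p.2 = i := Finset.HasAntidiagonal.mem_antidiagonal.1 hp
  have hcomm : ((l - r) ^ p.1 * r ^ p.2) V = iteratedCommutator X p.1 V * X ^ p.2 := by
    rw [(hc.pow_pow p.1 p.2).eq, Module.End.mul_apply, had]
    simp only [r, LinearMap.pow_mulRight, LinearMap.mulRight_apply]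
  have hchoose : (i.factorial : ℂ)⁻¹ * (i.choose p.1 : ℂ) =
      (p.1.factorial : ℂ)⁻¹ * (p.2.factorial : ℂ)⁻¹ := by
    have h1 := Nat.choose_mul_factorial_mul_factorial (Nat.le.intro hp')
    rw [← hp', Nat.add_sub_cancel_left, hp'] at h1
    have h2 : ((i.choose p.1 : ℂ)) * p.1.factorial * p.2.factorial = i.factorial := by
      exact_mod_cast h1
    have e1 : (p.1.factorial : ℂ) ≠ 0 := by exact_mod_cast p.1.factorial_ne_zero
    have e2 : (p.2.factorial : ℂ) ≠ 0 := by exact_mod_cast p.2.factorial_ne_zero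
    have e3 : (i.factorial : ℂ) ≠ 0 := by exact_mod_cast i.factorial_ne_zero
    field_simp
    linear_combination h2
  rw [LinearMap.smul_apply]
  change _ • _ • ((l - r) ^ p.1 * r ^ p.2) V = _
  rw [hcomm, ← Nat.cast_smul_eq_nsmul ℂ, smul_smul, hchoose, Matrix.smul_mul, Matrix.mul_smul,
    smul_smul]

/-- The coefficient of `x ^ k` in `exp (x X) * exp (x Y)`. -/
noncomputable def expMulExpCoeff (X Y : Matrix n n ℂ) (k : ℕ) : Matrix n n ℂ :=
  ∑ p ∈ antidiagonal k, ((p.1.factorial : ℂ)⁻¹ • X ^ p.1) * ((p.2.factorial : ℂ)⁻¹ • Y ^ p.2)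

theorem succ_smul_inv_factorial_pow (X : Matrix n n ℂ) (i : ℕ) :
    ((i : ℂ) + 1) • (((i + 1).factorial : ℂ)⁻¹ • X ^ (i + 1)) =
      X * ((i.factorial : ℂ)⁻¹ • X ^ i) := by
  have e1 : (i.factorial : ℂ) ≠ 0 := by exact_mod_cast i.factorial_ne_zero
  have e2 : (i : ℂ) + 1 ≠ 0 := by exact_mod_cast i.succ_ne_zero
  rw [smul_smul, Matrix.mul_smul, ← pow_succ', Nat.factorial_succ]
  congr 1
  push_cast
  field_simp

/-- The differential equation of the interaction picture, `F' x = V x * F x`, coefficient by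
coefficient, for `F x = exp (x X) * exp (x (V - X))`. -/
theorem succ_smul_expMulExpCoeff (X V : Matrix n n ℂ) (k : ℕ) :
    ((k : ℂ) + 1) • expMulExpCoeff X (V - X) (k + 1) = ∑ p ∈ antidiagonal k,
      ((p.1.factorial : ℂ)⁻¹ • iteratedCommutator X p.1 V) * expMulExpCoeff X (V - X) p.2 := by
  set a : ℕ → Matrix n n ℂ := fun i => (i.factorial : ℂ)⁻¹ • X ^ i with ha
  set b : ℕ → Matrix n n ℂ := fun i => (i.factorial : ℂ)⁻¹ • (V - X) ^ i with hb
  have ha' : ∀ i : ℕ, ((i : ℂ) + 1) • a (i + 1) = X * a i := succ_smul_inv_factorial_pow X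
  have hb' : ∀ i : ℕ, ((i : ℂ) + 1) • b (i + 1) = (V - X) * b i :=
    succ_smul_inv_factorial_pow (V - X)
  have hV : ∀ i : ℕ, a i * V = ∑ p ∈ antidiagonal i,
      ((p.1.factorial : ℂ)⁻¹ • iteratedCommutator X p.1 V) * a p.2 :=
    pow_mul_eq_sum_iteratedCommutator X V
  have hXa : ∀ i, X * a i = a i * X := fun i => by
    simp only [ha, Matrix.mul_smul, Matrix.smul_mul, ← pow_succ, ← pow_succ']
  have h1 : ((k : ℂ) + 1) • expMulExpCoeff X (V - X) (k + 1) =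
      ∑ p ∈ antidiagonal k, a p.1 * V * b p.2 := by
    have hL : ((k : ℂ) + 1) • expMulExpCoeff X (V - X) (k + 1) =
        ∑ p ∈ antidiagonal (k + 1), ((p.1 : ℂ) • a p.1) * b p.2 +
          ∑ p ∈ antidiagonal (k + 1), a p.1 * ((p.2 : ℂ) • b p.2) := by
      rw [← Finset.sum_add_distrib, expMulExpCoeff, Finset.smul_sum]
      refine Finset.sum_congr rfl fun p hp => ?_
      have hp' : p.1 + p.2 = k + 1 := Finset.HasAntidiagonal.mem_antidiagonal.1 hp
      change _ • (a p.1 * b p.2) = _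
      rw [Matrix.smul_mul (p.1 : ℂ), Matrix.mul_smul _ (p.2 : ℂ), ← add_smul]
      congr 1
      exact_mod_cast hp'.symm
    rw [hL, Finset.Nat.sum_antidiagonal_succ, Finset.Nat.sum_antidiagonal_succ']
    simp only [Nat.cast_zero, zero_smul, Matrix.zero_mul, Matrix.mul_zero, zero_add, Nat.cast_add,
      Nat.cast_one, ha', hb']
    rw [← Finset.sum_add_distrib]
    refine Finset.sum_congr rfl fun p _ => ?_
    rw [hXa]
    noncomm_ring
  have h2 : ∀ i, expMulExpCoeff X (V - X) i = ∑ p ∈ antidiagonal i, a p.1 * b p.2 := fun i => rfl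
  rw [h1]
  simp only [h2, hV, Finset.mul_sum, Finset.sum_mul, Finset.sum_sigma']
  refine Finset.sum_nbij' (fun q => ⟨(q.2.1, q.2.2 + q.1.2), (q.2.2, q.1.2)⟩)
    (fun q => ⟨(q.1.1 + q.2.1, q.2.2), (q.1.1, q.2.1)⟩) ?_ ?_ ?_ ?_ ?_
  · rintro ⟨⟨i, j⟩, ⟨k, l⟩⟩ h
    simp only [Finset.mem_sigma, Finset.HasAntidiagonal.mem_antidiagonal] at h ⊢
    exact ⟨by omega, trivial⟩
  · rintro ⟨⟨i, j⟩, ⟨k, l⟩⟩ h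
    simp only [Finset.mem_sigma, Finset.HasAntidiagonal.mem_antidiagonal] at h ⊢
    exact ⟨by omega, trivial⟩
  · rintro ⟨⟨i, j⟩, ⟨k, l⟩⟩ h
    simp only [Finset.mem_sigma, Finset.HasAntidiagonal.mem_antidiagonal] at h ⊢
    rw [h.2]
  · rintro ⟨⟨i, j⟩, ⟨k, l⟩⟩ h
    simp only [Finset.mem_sigma, Finset.HasAntidiagonal.mem_antidiagonal] at h ⊢
    rw [h.2]
  · rintro ⟨⟨i, j⟩, ⟨k, l⟩⟩ h
    simp only [mul_assoc]

theorem summable_norm_expMulExpCoeff_and_tsum (X Y : Matrix n n ℂ) (x : ℂ) :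
    Summable (fun k => ‖x ^ k • expMulExpCoeff X Y k‖) ∧
      ∑' k, x ^ k • expMulExpCoeff X Y k =
        NormedSpace.exp (x • X) * NormedSpace.exp (x • Y) := by
  have hX := NormedSpace.norm_expSeries_summable' (𝕂 := ℂ) (x • X)
  have hY := NormedSpace.norm_expSeries_summable' (𝕂 := ℂ) (x • Y)
  have hcoeff : ∀ k, x ^ k • expMulExpCoeff X Y k = ∑ p ∈ antidiagonal k,
      ((p.1.factorial : ℂ)⁻¹ • (x • X) ^ p.1) * ((p.2.factorial : ℂ)⁻¹ • (x • Y) ^ p.2) := by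
    intro k
    rw [expMulExpCoeff, Finset.smul_sum]
    refine Finset.sum_congr rfl fun p hp => ?_
    rw [← Finset.HasAntidiagonal.mem_antidiagonal.1 hp]
    simp only [smul_pow, Matrix.smul_mul, Matrix.mul_smul, smul_smul, pow_add]
    congr 1
    ring
  have hs := summable_norm_sum_mul_antidiagonal_of_summable_norm hX hY
  refine ⟨by simpa only [hcoeff] using hs, ?_⟩
  rw [tsum_congr hcoeff, ← tsum_mul_tsum_eq_tsum_sum_antidiagonal_of_summable_norm hX hY,
    (NormedSpace.exp_series_hasSum_exp' (𝕂 := ℂ) (x • X)).tsum_eq,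
    (NormedSpace.exp_series_hasSum_exp' (𝕂 := ℂ) (x • Y)).tsum_eq]

/-- A letter `(s, j)` stands for the `s`-fold commutator with the `j`-th interaction term and
contributes `s + 1` powers of the time; the degree of a word is its total power. -/
def wordDegree (w : List (ℕ × ℕ)) : ℕ :=
  (w.map fun l => l.1 + 1).sum

/-- The term of the Dyson expansion at time `x` indexed by a word in the letters `B`. The
denominators come from integrating the monomial over the ordered times. -/
noncomputable def dysonTerm (x : ℂ) (B : ℕ × ℕ → Matrix n n ℂ) : List (ℕ × ℕ) → Matrix n n ℂ
  | [] => 1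
  | l :: w => (x ^ (l.1 + 1) / (wordDegree (l :: w) : ℂ)) • (B l * dysonTerm x B w)

theorem norm_matrix_one_le : ‖(1 : Matrix n n ℂ)‖ ≤ 1 := by
  rw [← Matrix.diagonal_one, Matrix.l2_opNorm_diagonal]
  exact (pi_norm_const_le _).trans (by simp)

theorem norm_dysonTerm_le (x : ℂ) (B : ℕ × ℕ → Matrix n n ℂ) (w : List (ℕ × ℕ)) :
    ‖dysonTerm x B w‖ ≤ (w.map fun l => ‖x‖ ^ (l.1 + 1) * ‖B l‖).prod := by
  induction w with
  | nil => exact norm_matrix_one_le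
  | cons l w ih =>
    rw [dysonTerm, List.map_cons, List.prod_cons, norm_smul, norm_div, norm_pow]
    have h1 : (1 : ℝ) ≤ ‖(wordDegree (l :: w) : ℂ)‖ := by
      rw [Complex.norm_natCast, Nat.one_le_cast, wordDegree, List.map_cons, List.sum_cons]
      omega
    have h2 : ‖x‖ ^ (l.1 + 1) / ‖(wordDegree (l :: w) : ℂ)‖ ≤ ‖x‖ ^ (l.1 + 1) :=
      div_le_self (by positivity) h1
    rw [mul_assoc]
    refine mul_le_mul h2 ((norm_mul_le _ _).trans ?_) (norm_nonneg _) (by positivity)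
    exact mul_le_mul_of_nonneg_left ih (norm_nonneg _)

/-- The words of degree `k` sum to the `k`-th power series coefficient: peeling off the first
letter of a word reproduces the recursion `succ_smul_expMulExpCoeff`. -/
theorem tsum_dysonTerm_of_degree (X V : Matrix n n ℂ) (x : ℂ) {B : ℕ × ℕ → Matrix n n ℂ}
    (hB : ∀ s, HasSum (fun j => B (s, j)) ((s.factorial : ℂ)⁻¹ • iteratedCommutator X s V))
    (hsum : Summable fun w => ‖dysonTerm x B w‖) (k : ℕ) :
    ∑' w, (if wordDegree w = k then dysonTerm x B w else 0) =
      x ^ k • expMulExpCoeff X (V - X) k := by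
  have hs : ∀ k, Summable fun w => if wordDegree w = k then dysonTerm x B w else 0 := fun k =>
    (hsum.of_norm.indicator {w | wordDegree w = k}).congr fun w => by
      simp [Set.indicator_apply]
  induction k using Nat.strong_induction_on with
  | _ k ih =>
  rcases k with _ | k
  · rw [tsum_list (hs 0)]
    simp [wordDegree, dysonTerm, expMulExpCoeff]
  · have hs' := summable_list_iff.1 (hs (k + 1))
    rw [tsum_list (hs (k + 1)), hs'.tsum_prod]
    have hinner : ∀ l : ℕ × ℕ, ∑' w, (if wordDegree (l :: w) = k + 1 then
        dysonTerm x B (l :: w) else 0) =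
        if l.1 ≤ k then (x ^ (k + 1) / ((k : ℂ) + 1)) •
          (B l * expMulExpCoeff X (V - X) (k - l.1)) else 0 := by
      intro l
      split_ifs with hl
      · have : ∀ w, (if wordDegree (l :: w) = k + 1 then dysonTerm x B (l :: w) else 0) =
            (x ^ (l.1 + 1) / ((k : ℂ) + 1)) •
              (B l * if wordDegree w = k - l.1 then dysonTerm x B w else 0) := by
          intro w
          have hd : wordDegree (l :: w) = l.1 + 1 + wordDegree w := by simp [wordDegree]
          by_cases h : wordDegree w = k - l.1
          · have hk : wordDegree (l :: w) = k + 1 := by omega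
            rw [if_pos hk, if_pos h, dysonTerm, hk]
            push_cast
            rfl
          · rw [if_neg h, if_neg (by omega)]
            simp
        rw [tsum_congr this, tsum_const_smul'', (hs _).tsum_mul_left, ih _ (by omega),
          Matrix.mul_smul, smul_smul]
        congr 1
        have : x ^ (k + 1) = x ^ (l.1 + 1) * x ^ (k - l.1) := by
          rw [← pow_add]
          congr 1
          omega
        rw [this]
        ring
      · have : ∀ w, (if wordDegree (l :: w) = k + 1 then dysonTerm x B (l :: w) else 0) = 0 := by
          intro w
          have hd : wordDegree (l :: w) = l.1 + 1 + wordDegree w := by simp [wordDegree]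
          exact if_neg (by omega)
        simp [this]
    have hs'' : Summable fun l : ℕ × ℕ => if l.1 ≤ k then (x ^ (k + 1) / ((k : ℂ) + 1)) •
          (B l * expMulExpCoeff X (V - X) (k - l.1)) else 0 := by
      simpa only [hinner] using hs'.prod
    have hnil : (if wordDegree [] = k + 1 then dysonTerm x B [] else 0) = 0 :=
      if_neg (by simp [wordDegree])
    rw [tsum_congr hinner, hs''.tsum_prod, hnil, zero_add]
    have hj : ∀ s, ∑' j, (if s ≤ k then (x ^ (k + 1) / ((k : ℂ) + 1)) •
          (B (s, j) * expMulExpCoeff X (V - X) (k - s)) else 0) =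
        if s ≤ k then (x ^ (k + 1) / ((k : ℂ) + 1)) •
          (((s.factorial : ℂ)⁻¹ • iteratedCommutator X s V) *
            expMulExpCoeff X (V - X) (k - s)) else 0 := by
      intro s
      split_ifs
      · rw [tsum_const_smul'', (hB s).summable.tsum_mul_right, (hB s).tsum_eq]
      · simp
    rw [tsum_congr hj, tsum_eq_sum (s := Finset.range (k + 1)) fun s hs => if_neg (by simpa using hs)]
    have hk : (k : ℂ) + 1 ≠ 0 := by exact_mod_cast k.succ_ne_zero
    have hrec := succ_smul_expMulExpCoeff X V k
    rw [Finset.Nat.sum_antidiagonal_eq_sum_range_succ_mk] at hrec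
    have hrec' : expMulExpCoeff X (V - X) (k + 1) = ((k : ℂ) + 1)⁻¹ •
        (((k : ℂ) + 1) • expMulExpCoeff X (V - X) (k + 1)) := by
      rw [smul_smul, inv_mul_cancel₀ hk, one_smul]
    rw [hrec', hrec, smul_smul, Finset.smul_sum]
    refine Finset.sum_congr rfl fun s hs => ?_
    rw [if_pos (Nat.lt_succ_iff.1 (Finset.mem_range.1 hs))]
    rfl

/-- The Dyson expansion of the interaction-picture propagator `exp (x X) * exp (x (V - X))`. -/
theorem tsum_dysonTerm (X V : Matrix n n ℂ) (x : ℂ) {B : ℕ × ℕ → Matrix n n ℂ}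
    (hB : ∀ s, HasSum (fun j => B (s, j)) ((s.factorial : ℂ)⁻¹ • iteratedCommutator X s V))
    (hsum : Summable fun w => ‖dysonTerm x B w‖) :
    ∑' w, dysonTerm x B w = NormedSpace.exp (x • X) * NormedSpace.exp (x • (V - X)) := by
  rw [← (summable_norm_expMulExpCoeff_and_tsum X (V - X) x).2]
  rw [← (hsum.of_norm.hasSum.tsum_fiberwise wordDegree).tsum_eq]
  refine tsum_congr fun k => ?_
  rw [← tsum_dysonTerm_of_degree X V x hB hsum k, tsum_subtype (wordDegree ⁻¹' {k})]
  refine tsum_congr fun w => ?_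
  by_cases h : wordDegree w = k
  · rw [if_pos h, Set.indicator_of_mem (show w ∈ wordDegree ⁻¹' {k} from h)]
  · rw [if_neg h, Set.indicator_of_notMem (show w ∉ wordDegree ⁻¹' {k} from h)]

end Dyson

/-! ### Truncating the Dyson expansion -/

/-- The weight `2 ^ (s + 1) * (j + 1) ^ (κ / 2)` of the letter `(s, j)`. Words of large weight are
discarded; the Dyson series still converges against the weight. -/
noncomputable def letterWeight (κ : ℝ) (l : ℕ × ℕ) : ℝ :=
  2 ^ (l.1 + 1) * ((l.2 : ℝ) + 1) ^ (κ / 2)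

/-- The weight of a word is the product of the weights of its letters. -/
noncomputable def wordWeight (κ : ℝ) (w : List (ℕ × ℕ)) : ℝ :=
  (w.map (letterWeight κ)).prod

theorem two_le_letterWeight {κ : ℝ} (hκ : 0 < κ) (l : ℕ × ℕ) : 2 ≤ letterWeight κ l := by
  have h1 : (2 : ℝ) ≤ 2 ^ (l.1 + 1) := le_self_pow₀ one_le_two (Nat.succ_ne_zero _)
  have h2 : (1 : ℝ) ≤ ((l.2 : ℝ) + 1) ^ (κ / 2) :=
    Real.one_le_rpow (by linarith [Nat.cast_nonneg (α := ℝ) l.2]) (by linarith)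
  unfold letterWeight
  nlinarith

theorem two_pow_length_le_wordWeight {κ : ℝ} (hκ : 0 < κ) (w : List (ℕ × ℕ)) :
    2 ^ w.length ≤ wordWeight κ w := by
  induction w with
  | nil => simp [wordWeight]
  | cons l w ih =>
    rw [wordWeight, List.map_cons, List.prod_cons, List.length_cons, pow_succ']
    exact mul_le_mul (two_le_letterWeight hκ l) ih (by positivity)
      (zero_le_two.trans (two_le_letterWeight hκ l))

theorem one_le_wordWeight {κ : ℝ} (hκ : 0 < κ) (w : List (ℕ × ℕ)) : 1 ≤ wordWeight κ w :=
  (one_le_pow₀ one_le_two).trans (two_pow_length_le_wordWeight hκ w)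

/-- The weighted norms of the letters sum to at most `8 z C₀ g ≤ 2 / e < 3 / 4`. -/
theorem tsum_letters_le {v : ℕ → ℝ} (hv : ∀ j, 0 ≤ v j) (hs : Summable v) {C₀ κ Q z : ℝ}
    (hC₀ : 1 ≤ C₀) (hκ : 0 < κ) (hQ : 0 ≤ Q) (hz : 0 ≤ z)
    (htail : ∀ D : ℕ, ∑' j, v (D + j) ≤ C₀ * (∑' j, v j) * ((D : ℝ) + 1) ^ (-κ))
    (hzQ : z * rateQ0 Q C₀ (∑' j, v j) ≤ 1) :
    Summable (fun l : ℕ × ℕ => letterWeight κ l * (z ^ (l.1 + 1) * (Q ^ l.1 * v l.2))) ∧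
      ∑' l : ℕ × ℕ, letterWeight κ l * (z ^ (l.1 + 1) * (Q ^ l.1 * v l.2)) ≤ 3 / 4 := by
  set g := ∑' j, v j with hg
  have hg0 : 0 ≤ g := tsum_nonneg hv
  have hM : 0 ≤ C₀ * g := by positivity
  obtain ⟨hu, hu'⟩ := tsum_mul_rpow_half_le hv hs hM hκ htail
  have hQ1 : 2 * z * Q ≤ 1 / 2 := by
    have := mul_le_mul_of_nonneg_left (le_max_left (4 * Q) (4 * Real.exp 1 * C₀ * g)) hz
    rw [rateQ0] at hzQ
    linarith
  have hg1 : z * (C₀ * g) * Real.exp 1 ≤ 1 / 4 := by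
    have := mul_le_mul_of_nonneg_left (le_max_right (4 * Q) (4 * Real.exp 1 * C₀ * g)) hz
    rw [rateQ0] at hzQ
    linarith
  have hq0 : 0 ≤ 2 * z * Q := by positivity
  have hgeom : HasSum (fun s : ℕ => 2 * z * (2 * z * Q) ^ s) (2 * z * (1 - 2 * z * Q)⁻¹) :=
    (hasSum_geometric_of_lt_one hq0 (by linarith)).mul_left _
  have hfun : (fun l : ℕ × ℕ => letterWeight κ l * (z ^ (l.1 + 1) * (Q ^ l.1 * v l.2))) =
      fun l => 2 * z * (2 * z * Q) ^ l.1 * (v l.2 * ((l.2 : ℝ) + 1) ^ (κ / 2)) := by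
    funext l
    rw [letterWeight, pow_succ, pow_succ, mul_pow, mul_pow]
    ring
  rw [hfun]
  have hprod : Summable fun l : ℕ × ℕ =>
      2 * z * (2 * z * Q) ^ l.1 * (v l.2 * ((l.2 : ℝ) + 1) ^ (κ / 2)) :=
    hgeom.summable.mul_of_nonneg hu (fun s => by positivity)
      fun j => mul_nonneg (hv j) (by positivity)
  refine ⟨hprod, ?_⟩
  rw [← hgeom.summable.tsum_mul_tsum hu hprod, hgeom.tsum_eq]
  have hinv : (1 - 2 * z * Q)⁻¹ ≤ 2 := by
    rw [inv_le_comm₀ (by linarith) two_pos]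
    linarith
  calc 2 * z * (1 - 2 * z * Q)⁻¹ * ∑' j : ℕ, v j * ((j : ℝ) + 1) ^ (κ / 2)
      ≤ 2 * z * 2 * (2 * (C₀ * g)) := by
        gcongr
        exact tsum_nonneg fun j => mul_nonneg (hv j) (by positivity)
    _ = 8 * (z * (C₀ * g)) := by ring
    _ ≤ 3 / 4 := by
        have := Real.exp_one_gt_d9
        nlinarith [mul_nonneg hz hM]

/-- Rankin's trick: words of weight at most `N` are counted, with multiplicity `s + 1` for each
letter `(s, j)`, by `(N / weight) ^ (5 + 4 / κ)`, and this sums to a convergent product. The summand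
`4 / κ` makes the sum over the indices `j` converge like `∑ 1 / j ^ 2`. -/
theorem prod_succ_le_of_wordWeight_le {κ N : ℝ} (hκ : 0 < κ) {w : List (ℕ × ℕ)}
    (hw : wordWeight κ w ≤ N) :
    (w.map fun l => (l.1 : ℝ) + 1).prod ≤ N ^ (5 + 4 / κ) *
      (w.map fun l => (1 / 16 : ℝ) ^ (l.1 + 1) * (((l.2 : ℝ) + 1) ^ 2)⁻¹).prod := by
  set y := 5 + 4 / κ with hy
  have hy5 : 5 ≤ y := by
    have : 0 < 4 / κ := by positivity
    linarith
  have hletter : ∀ l : ℕ × ℕ, (l.1 : ℝ) + 1 ≤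
      letterWeight κ l ^ y * ((1 / 16 : ℝ) ^ (l.1 + 1) * (((l.2 : ℝ) + 1) ^ 2)⁻¹) := by
    intro l
    have h1 : (32 : ℝ) ^ (l.1 + 1) ≤ ((2 : ℝ) ^ (l.1 + 1)) ^ y := by
      calc (32 : ℝ) ^ (l.1 + 1) = ((2 : ℝ) ^ (l.1 + 1)) ^ (5 : ℝ) := by
            rw [show (5 : ℝ) = ((5 : ℕ) : ℝ) by norm_num, Real.rpow_natCast, ← pow_mul, mul_comm,
              pow_mul]
            norm_num
        _ ≤ _ := Real.rpow_le_rpow_of_exponent_le (one_le_pow₀ one_le_two) hy5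
    have hj : (1 : ℝ) ≤ (l.2 : ℝ) + 1 := by linarith [Nat.cast_nonneg (α := ℝ) l.2]
    have h2 : ((l.2 : ℝ) + 1) ^ 2 ≤ (((l.2 : ℝ) + 1) ^ (κ / 2)) ^ y := by
      rw [← Real.rpow_mul (by linarith), ← Real.rpow_natCast]
      refine Real.rpow_le_rpow_of_exponent_le hj ?_
      have : κ / 2 * y = κ * 5 / 2 + 2 := by
        rw [hy]
        field_simp
        ring
      rw [this]
      push_cast
      linarith
    have h3 : (l.1 : ℝ) + 1 ≤ 2 ^ (l.1 + 1) := by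
      exact_mod_cast (Nat.lt_two_pow_self (n := l.1 + 1)).le
    have hj2 : (0 : ℝ) < ((l.2 : ℝ) + 1) ^ 2 := by positivity
    calc (l.1 : ℝ) + 1 ≤ 2 ^ (l.1 + 1) := h3
      _ = (32 : ℝ) ^ (l.1 + 1) * ((l.2 : ℝ) + 1) ^ 2 *
          ((1 / 16 : ℝ) ^ (l.1 + 1) * (((l.2 : ℝ) + 1) ^ 2)⁻¹) := by
          rw [mul_mul_mul_comm, mul_inv_cancel₀ hj2.ne', mul_one, ← mul_pow]
          norm_num
      _ ≤ _ := by
          rw [letterWeight, Real.mul_rpow (by positivity) (by positivity)]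
          gcongr
  have hword : (w.map fun l => (l.1 : ℝ) + 1).prod ≤ wordWeight κ w ^ y *
      (w.map fun l => (1 / 16 : ℝ) ^ (l.1 + 1) * (((l.2 : ℝ) + 1) ^ 2)⁻¹).prod := by
    clear hw
    induction w with
    | nil => simp [wordWeight]
    | cons l w ih =>
      have hl := zero_le_two.trans (two_le_letterWeight hκ l)
      have hw := zero_le_one.trans (one_le_wordWeight hκ w)
      have hww : wordWeight κ (l :: w) = letterWeight κ l * wordWeight κ w := by simp [wordWeight]
      simp only [List.map_cons, List.prod_cons]
      rw [hww, Real.mul_rpow hl hw, mul_mul_mul_comm]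
      exact mul_le_mul (hletter l) ih
        (List.prod_nonneg (by
          simp only [List.mem_map, forall_exists_index, and_imp, forall_apply_eq_imp_iff₂]
          intros
          positivity))
        (by positivity)
  refine hword.trans (mul_le_mul_of_nonneg_right ?_ ?_)
  · exact Real.rpow_le_rpow (zero_le_one.trans (one_le_wordWeight hκ w)) hw (by linarith)
  · refine List.prod_nonneg ?_
    simp only [List.mem_map, forall_exists_index, and_imp, forall_apply_eq_imp_iff₂]
    intros
    positivity

theorem tsum_words_rankin_le :
    Summable (fun w : List (ℕ × ℕ) =>
      (w.map fun l => (1 / 16 : ℝ) ^ (l.1 + 1) * (((l.2 : ℝ) + 1) ^ 2)⁻¹).prod) ∧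
    ∑' w : List (ℕ × ℕ),
      (w.map fun l => (1 / 16 : ℝ) ^ (l.1 + 1) * (((l.2 : ℝ) + 1) ^ 2)⁻¹).prod ≤ 2 := by
  have h1 : HasSum (fun s : ℕ => (1 / 16 : ℝ) ^ (s + 1)) (1 / 15) := by
    have := (hasSum_geometric_of_lt_one (r := (1 / 16 : ℝ)) (by norm_num)
      (by norm_num)).mul_left (1 / 16)
    convert! this using 1
    · funext s
      rw [pow_succ']
    · norm_num
  have h2 : HasSum (fun j : ℕ => (((j : ℝ) + 1) ^ 2)⁻¹) (Real.pi ^ 2 / 6) := by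
    have := (hasSum_nat_add_iff' 1).2 hasSum_zeta_two
    simpa using this
  have h3 : Summable fun l : ℕ × ℕ => (1 / 16 : ℝ) ^ (l.1 + 1) * (((l.2 : ℝ) + 1) ^ 2)⁻¹ :=
    h1.summable.mul_of_nonneg h2.summable (fun s => by positivity) fun j => by positivity
  have h4 : ∑' l : ℕ × ℕ, (1 / 16 : ℝ) ^ (l.1 + 1) * (((l.2 : ℝ) + 1) ^ 2)⁻¹ ≤ 1 / 2 := by
    rw [← h1.summable.tsum_mul_tsum h2.summable h3, h1.tsum_eq, h2.tsum_eq]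
    have := Real.pi_lt_four
    have := Real.pi_pos
    nlinarith
  have := summable_list_prod_and_tsum_le (fun l => by positivity) h3 h4 (by norm_num)
  norm_num at this ⊢
  exact this

section

variable {a b : Type*} [Fintype a] [DecidableEq a] [Fintype b] [DecidableEq b]

/-- The letters of the Dyson expansion, `(s, j) ↦ ad_X ^ s (V j) / s!`. -/
noncomputable def dysonLetter {n : Type*} [Fintype n] (X : Matrix n n ℂ) (V : ℕ → Matrix n n ℂ)
    (l : ℕ × ℕ) : Matrix n n ℂ :=
  (l.1.factorial : ℂ)⁻¹ • iteratedCommutator X l.1 (V l.2)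

theorem schmidtRank_dysonTerm_le (HA : Matrix a a ℂ) (HB : Matrix b b ℂ)
    {V : ℕ → Matrix (a × b) (a × b) ℂ} {D₀ : ℕ} (hrank : ∀ j, schmidtRank (V j) ≤ D₀)
    (x : ℂ) (w : List (ℕ × ℕ)) :
    schmidtRank (dysonTerm x (dysonLetter (-decoupledHamiltonian HA HB) V) w) ≤
      (w.map fun l => l.1 + 1).prod * D₀ ^ w.length := by
  induction w with
  | nil => simpa [dysonTerm] using schmidtRank_one_le
  | cons l w ih =>
    have hl : schmidtRank (dysonLetter (-decoupledHamiltonian HA HB) V l) ≤ (l.1 + 1) * D₀ := by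
      rw [dysonLetter, iteratedCommutator_neg]
      exact (schmidtRank_smul_le _ _).trans <| (schmidtRank_smul_le _ _).trans <|
        (schmidtRank_iteratedCommutator_le _ _ _ _).trans (Nat.mul_le_mul_left _ (hrank _))
    rw [dysonTerm]
    refine (schmidtRank_smul_le _ _).trans <| (schmidtRank_mul_le _ _).trans <|
      (Nat.mul_le_mul hl ih).trans_eq ?_
    simp only [List.map_cons, List.prod_cons, List.length_cons, pow_succ']
    ring

theorem schmidtRank_dysonTerm_le_of_wordWeight_le (HA : Matrix a a ℂ) (HB : Matrix b b ℂ)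
    {V : ℕ → Matrix (a × b) (a × b) ℂ} {D₀ : ℕ} (hD₀ : 1 ≤ D₀)
    (hrank : ∀ j, schmidtRank (V j) ≤ D₀) (x : ℂ) {κ N : ℝ} (hκ : 0 < κ) {w : List (ℕ × ℕ)}
    (hw : wordWeight κ w ≤ N) :
    (schmidtRank (dysonTerm x (dysonLetter (-decoupledHamiltonian HA HB) V) w) : ℝ) ≤
      N ^ (5 + 4 / κ + Real.logb 2 D₀) *
      (w.map fun l => (1 / 16 : ℝ) ^ (l.1 + 1) * (((l.2 : ℝ) + 1) ^ 2)⁻¹).prod := by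
  have hN : 0 < N := zero_lt_one.trans_le ((one_le_wordWeight hκ w).trans hw)
  have hD1 : (1 : ℝ) ≤ D₀ := by exact_mod_cast hD₀
  -- a word has at most `log₂ N` letters
  have h2 : (D₀ : ℝ) ^ w.length ≤ N ^ Real.logb 2 D₀ := by
    calc (D₀ : ℝ) ^ w.length = ((2 : ℝ) ^ w.length) ^ Real.logb 2 D₀ := by
          rw [← Real.rpow_natCast 2, ← Real.rpow_mul zero_le_two, mul_comm,
            Real.rpow_mul zero_le_two, Real.rpow_logb two_pos (by norm_num) (by linarith),
            Real.rpow_natCast]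
      _ ≤ _ := Real.rpow_le_rpow (by positivity) ((two_pow_length_le_wordWeight hκ w).trans hw)
          (Real.logb_nonneg one_lt_two hD1)
  calc (schmidtRank (dysonTerm x (dysonLetter (-decoupledHamiltonian HA HB) V) w) : ℝ)
      ≤ ((w.map fun l => l.1 + 1).prod * D₀ ^ w.length : ℕ) := by
        exact_mod_cast schmidtRank_dysonTerm_le HA HB hrank x w
    _ = (w.map fun l => (l.1 : ℝ) + 1).prod * (D₀ : ℝ) ^ w.length := by
        push_cast
        simp [List.map_map, Function.comp_def]
    _ ≤ (N ^ (5 + 4 / κ) *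
        (w.map fun l => (1 / 16 : ℝ) ^ (l.1 + 1) * (((l.2 : ℝ) + 1) ^ 2)⁻¹).prod) *
          N ^ Real.logb 2 D₀ := by
        have h3 := prod_succ_le_of_wordWeight_le hκ hw
        refine mul_le_mul h3 h2 (by positivity) (le_trans (List.prod_nonneg ?_) h3)
        simp only [List.mem_map, forall_exists_index, and_imp, forall_apply_eq_imp_iff₂]
        intros
        positivity
    _ = _ := by
        rw [Real.rpow_add hN (5 + 4 / κ)]
        ring

/-- The Dyson expansion converges absolutely to the interaction-picture propagator, with room to
spare for the weight of the words. -/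
theorem dysonTerm_weighted {n : Type*} [Fintype n] [DecidableEq n] {H₀ W : Matrix n n ℂ}
    {V : ℕ → Matrix n n ℂ} (hsum : Summable fun j => ‖V j‖) (hV : HasSum V W)
    {C₀ κ : ℝ} (hC₀ : 1 ≤ C₀) (hκ : 0 < κ)
    (htail : ∀ D : ℕ, ∑' j, ‖V (D + j)‖ ≤ C₀ * (∑' j, ‖V j‖) * ((D : ℝ) + 1) ^ (-κ))
    {Q : ℝ} (hQ : 0 ≤ Q)
    (had : ∀ j s : ℕ,
      1 / (s.factorial : ℝ) * ‖iteratedCommutator H₀ s (V j)‖ ≤ Q ^ s * ‖V j‖)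
    {x : ℂ} (hx : ‖x‖ * rateQ0 Q C₀ (∑' j, ‖V j‖) ≤ 1) :
    Summable (fun w => wordWeight κ w * ‖dysonTerm x (dysonLetter (-H₀) V) w‖) ∧
      ∑' w, wordWeight κ w * ‖dysonTerm x (dysonLetter (-H₀) V) w‖ ≤ 4 ∧
      HasSum (dysonTerm x (dysonLetter (-H₀) V))
        (NormedSpace.exp (x • (-H₀)) * NormedSpace.exp (x • (H₀ + W))) := by
  obtain ⟨hf, hf'⟩ := tsum_letters_le (fun j => norm_nonneg (V j)) hsum hC₀ hκ hQ (norm_nonneg x)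
    htail hx
  have hf0 : ∀ l : ℕ × ℕ, 0 ≤ letterWeight κ l * (‖x‖ ^ (l.1 + 1) * (Q ^ l.1 * ‖V l.2‖)) :=
    fun l => mul_nonneg (zero_le_two.trans (two_le_letterWeight hκ l)) (by positivity)
  obtain ⟨hw, hw'⟩ := summable_list_prod_and_tsum_le hf0 hf hf' (by norm_num)
  have hletter : ∀ l, ‖dysonLetter (-H₀) V l‖ ≤ Q ^ l.1 * ‖V l.2‖ := by
    intro l
    refine le_trans (le_of_eq ?_) (had l.2 l.1)
    rw [dysonLetter, iteratedCommutator_neg, norm_smul, norm_smul]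
    simp
  have hle : ∀ w, wordWeight κ w * ‖dysonTerm x (dysonLetter (-H₀) V) w‖ ≤
      (w.map fun l => letterWeight κ l * (‖x‖ ^ (l.1 + 1) * (Q ^ l.1 * ‖V l.2‖))).prod := by
    intro w
    rw [List.prod_map_mul]
    refine mul_le_mul_of_nonneg_left ((norm_dysonTerm_le _ _ _).trans ?_)
      (zero_le_one.trans (one_le_wordWeight hκ w))
    refine List.prod_map_le_prod_map₀ _ _ (fun l _ => by positivity) fun l _ => ?_
    exact mul_le_mul_of_nonneg_left (hletter l) (by positivity)
  have hnn : ∀ w, 0 ≤ wordWeight κ w * ‖dysonTerm x (dysonLetter (-H₀) V) w‖ := fun w =>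
    mul_nonneg (zero_le_one.trans (one_le_wordWeight hκ w)) (norm_nonneg _)
  have hs := hw.of_nonneg_of_le hnn hle
  refine ⟨hs, (hs.tsum_le_tsum hle hw).trans (hw'.trans (by norm_num)), ?_⟩
  have hsn : Summable fun w => ‖dysonTerm x (dysonLetter (-H₀) V) w‖ :=
    hs.of_nonneg_of_le (fun w => norm_nonneg _) fun w =>
      le_mul_of_one_le_left (norm_nonneg _) (one_le_wordWeight hκ w)
  have hB : ∀ s, HasSum (fun j => dysonLetter (-H₀) V (s, j))
      ((s.factorial : ℂ)⁻¹ • iteratedCommutator (-H₀) s W) := fun s =>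
    (hasSum_iteratedCommutator _ s hV).const_smul _
  have := tsum_dysonTerm (-H₀) W x hB hsn
  rw [sub_neg_eq_add, add_comm W] at this
  rw [← this]
  exact hsn.of_norm.hasSum

theorem norm_exp_neg_mul_exp_le {n : Type*} [Fintype n] [DecidableEq n] {H₀ W : Matrix n n ℂ}
    {V : ℕ → Matrix n n ℂ} (hsum : Summable fun j => ‖V j‖) (hV : HasSum V W)
    {C₀ κ : ℝ} (hC₀ : 1 ≤ C₀) (hκ : 0 < κ)
    (htail : ∀ D : ℕ, ∑' j, ‖V (D + j)‖ ≤ C₀ * (∑' j, ‖V j‖) * ((D : ℝ) + 1) ^ (-κ))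
    {Q : ℝ} (hQ : 0 ≤ Q)
    (had : ∀ j s : ℕ,
      1 / (s.factorial : ℝ) * ‖iteratedCommutator H₀ s (V j)‖ ≤ Q ^ s * ‖V j‖)
    {x : ℂ} (hx : ‖x‖ * rateQ0 Q C₀ (∑' j, ‖V j‖) ≤ 1) :
    ‖NormedSpace.exp (x • (-H₀)) * NormedSpace.exp (x • (H₀ + W))‖ ≤ 4 := by
  obtain ⟨hs, h4, hF⟩ := dysonTerm_weighted hsum hV hC₀ hκ htail hQ had hx
  rw [← hF.tsum_eq]
  refine (tsum_of_norm_bounded hs.hasSum fun w => ?_).trans h4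
  exact le_mul_of_one_le_left (norm_nonneg _) (one_le_wordWeight hκ w)

/-- Keeping the words of weight at most `N` costs an error `4 / N` by Markov's inequality, and
leaves a Schmidt rank polynomial in `N` by `prod_succ_le_of_wordWeight_le`. -/
theorem exists_truncated_propagator (HA : Matrix a a ℂ) (HB : Matrix b b ℂ)
    {W : Matrix (a × b) (a × b) ℂ}
    {V : ℕ → Matrix (a × b) (a × b) ℂ} (hsum : Summable fun j => ‖V j‖) (hV : HasSum V W)
    {D₀ : ℕ} (hD₀ : 1 ≤ D₀) (hrank : ∀ j, schmidtRank (V j) ≤ D₀)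
    {C₀ κ : ℝ} (hC₀ : 1 ≤ C₀) (hκ : 0 < κ)
    (htail : ∀ D : ℕ, ∑' j, ‖V (D + j)‖ ≤ C₀ * (∑' j, ‖V j‖) * ((D : ℝ) + 1) ^ (-κ))
    {Q : ℝ} (hQ : 0 ≤ Q)
    (had : ∀ j s : ℕ,
      1 / (s.factorial : ℝ) *
        ‖iteratedCommutator (decoupledHamiltonian HA HB) s (V j)‖ ≤ Q ^ s * ‖V j‖)
    {x : ℂ} (hx : ‖x‖ * rateQ0 Q C₀ (∑' j, ‖V j‖) ≤ 1) {N : ℝ} (hN : 2 ≤ N) :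
    ∃ F : Matrix (a × b) (a × b) ℂ,
      ‖F - NormedSpace.exp (x • (-decoupledHamiltonian HA HB)) *
        NormedSpace.exp (x • (decoupledHamiltonian HA HB + W))‖ ≤ 4 / N ∧
      (schmidtRank F : ℝ) ≤ N ^ (6 + 4 / κ + Real.logb 2 D₀) := by
  obtain ⟨hs, h4, hF⟩ := dysonTerm_weighted hsum hV hC₀ hκ htail hQ had hx
  set T := dysonTerm x (dysonLetter (-decoupledHamiltonian HA HB) V) with hT
  have hN0 : 0 < N := by linarith
  obtain ⟨hR, hR2⟩ := tsum_words_rankin_le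
  set h : List (ℕ × ℕ) → ℝ := fun w =>
    (w.map fun l => (1 / 16 : ℝ) ^ (l.1 + 1) * (((l.2 : ℝ) + 1) ^ 2)⁻¹).prod with hh
  have hfin : {w | wordWeight κ w ≤ N}.Finite := by
    -- each word kept contributes at least `N ^ (-(5 + 4 / κ))` to a convergent series
    have hpos : 0 < (N ^ (5 + 4 / κ))⁻¹ := by positivity
    have hev := hR.tendsto_cofinite_zero.eventually (gt_mem_nhds hpos)
    refine Set.Finite.subset (Filter.eventually_cofinite.1 hev) fun w hw => ?_
    have h1 := prod_succ_le_of_wordWeight_le hκ hw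
    have h2 : (1 : ℝ) ≤ (w.map fun l => (l.1 : ℝ) + 1).prod := by
      clear h1 hw
      induction w with
      | nil => simp
      | cons l w ih =>
        rw [List.map_cons, List.prod_cons]
        exact one_le_mul_of_one_le_of_one_le (by linarith [Nat.cast_nonneg (α := ℝ) l.1]) ih
    rw [Set.mem_ofPred_eq, not_lt, inv_le_iff_one_le_mul₀' (by positivity)]
    exact h2.trans h1
  refine ⟨∑ w ∈ hfin.toFinset, T w, ?_, ?_⟩
  · have hsplit := hF.sub (hasSum_sum_of_ne_finset_zero (s := hfin.toFinset)
      (f := fun w => if w ∈ hfin.toFinset then T w else 0) fun w hw => if_neg hw)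
    rw [Finset.sum_congr rfl fun w (hw : w ∈ hfin.toFinset) => if_pos hw] at hsplit
    rw [norm_sub_rev, ← hsplit.tsum_eq]
    refine (tsum_of_norm_bounded (hs.mul_left N⁻¹).hasSum fun w => ?_).trans ?_
    · have hw1 := one_le_wordWeight hκ w
      split_ifs with hw
      · rw [sub_self, norm_zero]
        positivity
      · have hw' : N < wordWeight κ w := by simpa using hw
        rw [sub_zero, ← mul_assoc]
        refine le_mul_of_one_le_left (norm_nonneg _) ?_
        rw [inv_mul_eq_div, one_le_div hN0]
        exact hw'.le
    · rw [tsum_mul_left, inv_mul_eq_div]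
      gcongr
  · calc (schmidtRank (∑ w ∈ hfin.toFinset, T w) : ℝ)
        ≤ ∑ w ∈ hfin.toFinset, (schmidtRank (T w) : ℝ) := by
          exact_mod_cast schmidtRank_sum_le _ _
      _ ≤ ∑ w ∈ hfin.toFinset, N ^ (5 + 4 / κ + Real.logb 2 D₀) * h w :=
          Finset.sum_le_sum fun w hw => schmidtRank_dysonTerm_le_of_wordWeight_le HA HB hD₀ hrank x
            hκ (by simpa using hw)
      _ = N ^ (5 + 4 / κ + Real.logb 2 D₀) * ∑ w ∈ hfin.toFinset, h w := by
          rw [Finset.mul_sum]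
      _ ≤ N ^ (5 + 4 / κ + Real.logb 2 D₀) * N := by
          refine mul_le_mul_of_nonneg_left ?_ (by positivity)
          refine (hR.sum_le_tsum _ fun w _ => List.prod_nonneg ?_).trans (hR2.trans hN)
          simp only [List.mem_map, forall_exists_index, and_imp, forall_apply_eq_imp_iff₂]
          intros
          positivity
      _ = N ^ (6 + 4 / κ + Real.logb 2 D₀) := by
          rw [← Real.rpow_add_one hN0.ne']
          congr 1
          ring

end

/-! ### Hölder's inequality for traces of products -/

section Hoelder

open Complex

variable {n : Type*} [Fintype n] [DecidableEq n]

/-- The power `t ^ z` of `t ≥ 0`, with value `0` at `t = 0` for every `z`, so that powers are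
multiplicative in `z` without restriction. -/
noncomputable def supportedPow (t : ℝ) (z : ℂ) : ℂ :=
  if t = 0 then 0 else (t : ℂ) ^ z

theorem supportedPow_add (t : ℝ) (z w : ℂ) :
    supportedPow t (z + w) = supportedPow t z * supportedPow t w := by
  unfold supportedPow
  split_ifs with h
  · simp
  · exact Complex.cpow_add _ _ (by exact_mod_cast h)

theorem norm_supportedPow_le_one {t : ℝ} (ht : 0 ≤ t) {z : ℂ} (hz : z.re = 0) :
    ‖supportedPow t z‖ ≤ 1 := by
  unfold supportedPow
  split_ifs with h
  · simp
  · rw [Complex.norm_cpow_eq_rpow_re_of_pos (ht.lt_of_ne' h), hz, Real.rpow_zero]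

theorem supportedPow_one (t : ℝ) : supportedPow t 1 = t := by
  unfold supportedPow
  split_ifs with h <;> simp [h]

theorem supportedPow_ofReal {t : ℝ} (ht : 0 < t) (x : ℝ) :
    supportedPow t x = ((t ^ x : ℝ) : ℂ) := by
  rw [supportedPow, if_neg ht.ne', Complex.ofReal_cpow ht.le]

theorem differentiable_supportedPow (t : ℝ) : Differentiable ℂ (supportedPow t) := by
  unfold supportedPow
  split_ifs with h
  · exact differentiable_const _
  · intro z
    have : (t : ℂ) ≠ 0 := by exact_mod_cast h
    exact (differentiableAt_id).const_cpow (Or.inl this)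

/-- The power `A ^ z` of the positive semidefinite matrix `A = V diag(t) V†`, supported on the
range of `A`. -/
noncomputable def spectralPow (V : Matrix n n ℂ) (t : n → ℝ) (z : ℂ) : Matrix n n ℂ :=
  V * Matrix.diagonal (fun k => supportedPow (t k) z) * star V

theorem norm_le_one_of_mem_unitaryGroup {V : Matrix n n ℂ} (hV : V ∈ Matrix.unitaryGroup n ℂ) :
    ‖V‖ ≤ 1 := by
  have h := CStarRing.norm_star_mul_self (x := V)
  rw [(Matrix.mem_unitaryGroup_iff').1 hV] at h
  nlinarith [norm_matrix_one_le (n := n), norm_nonneg V]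

theorem norm_conj_diagonal_le {V : Matrix n n ℂ} (hV : V ∈ Matrix.unitaryGroup n ℂ) {d : n → ℂ}
    {c : ℝ} (hc : 0 ≤ c) (hd : ∀ k, ‖d k‖ ≤ c) : ‖V * Matrix.diagonal d * star V‖ ≤ c := by
  have hV1 := norm_le_one_of_mem_unitaryGroup hV
  have hV2 : ‖star V‖ ≤ 1 := by rwa [norm_star]
  have hd' : ‖Matrix.diagonal d‖ ≤ c := by
    rw [Matrix.l2_opNorm_diagonal]
    exact (pi_norm_le_iff_of_nonneg hc).2 hd
  calc ‖V * Matrix.diagonal d * star V‖ ≤ ‖V‖ * ‖Matrix.diagonal d‖ * ‖star V‖ :=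
        (norm_mul_le _ _).trans (mul_le_mul_of_nonneg_right (norm_mul_le _ _) (norm_nonneg _))
    _ ≤ 1 * c * 1 := by gcongr
    _ = c := by ring

theorem spectralPow_add {V : Matrix n n ℂ} (hV : V ∈ Matrix.unitaryGroup n ℂ) (t : n → ℝ)
    (z w : ℂ) : spectralPow V t (z + w) = spectralPow V t z * spectralPow V t w := by
  have h : ∀ D E : Matrix n n ℂ, V * D * star V * (V * E * star V) = V * (D * E) * star V := by
    intro D E
    calc _ = V * D * (star V * V) * E * star V := by simp only [mul_assoc]
      _ = _ := by rw [(Matrix.mem_unitaryGroup_iff').1 hV, mul_one, mul_assoc V]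
  simp only [spectralPow, h, Matrix.diagonal_mul_diagonal, supportedPow_add]

theorem norm_spectralPow_le_one {V : Matrix n n ℂ} (hV : V ∈ Matrix.unitaryGroup n ℂ) {t : n → ℝ}
    (ht : ∀ k, 0 ≤ t k) {z : ℂ} (hz : z.re = 0) : ‖spectralPow V t z‖ ≤ 1 :=
  norm_conj_diagonal_le hV zero_le_one fun k => norm_supportedPow_le_one (ht k) hz

theorem differentiable_spectralPow (V : Matrix n n ℂ) (t : n → ℝ) :
    Differentiable ℂ (spectralPow V t) := by
  have h : Differentiable ℂ fun z => Matrix.diagonal fun k => supportedPow (t k) z := by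
    have h1 : Differentiable ℂ fun z => fun k => supportedPow (t k) z :=
      differentiable_pi.2 fun k => differentiable_supportedPow (t k)
    exact (LinearMap.toContinuousLinearMap
      (Matrix.diagonalLinearMap n ℂ ℂ)).differentiable.comp h1
  exact (h.const_mul V).mul_const (star V)

theorem norm_entry_le (M : Matrix n n ℂ) (i j : n) : ‖M i j‖ ≤ ‖M‖ := by
  have h := M.l2_opNorm_mulVec (EuclideanSpace.single j (1 : ℂ))
  rw [PiLp.norm_single, norm_one, mul_one] at h
  refine le_trans ?_ h
  refine le_trans (le_of_eq ?_) (PiLp.norm_apply_le _ i)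
  simp

theorem norm_trace_le (M : Matrix n n ℂ) : ‖M.trace‖ ≤ Fintype.card n * ‖M‖ := by
  refine (norm_sum_le _ _).trans ((Finset.sum_le_card_nsmul _ _ _ fun i _ =>
    norm_entry_le M i i).trans_eq ?_)
  simp

/-- The trace pairing of a positive semidefinite matrix with a matrix of norm at most `1` is
bounded by its trace. -/
theorem norm_trace_spectralPow_one_mul_le {V : Matrix n n ℂ} (hV : V ∈ Matrix.unitaryGroup n ℂ)
    {t : n → ℝ} (ht : ∀ k, 0 ≤ t k) (X : Matrix n n ℂ) :
    ‖(spectralPow V t 1 * X).trace‖ ≤ (∑ k, t k) * ‖X‖ := by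
  have h1 : (spectralPow V t 1 * X).trace = ∑ k, (t k : ℂ) * (star V * X * V) k k := by
    rw [spectralPow, mul_assoc, mul_assoc, Matrix.trace_mul_comm]
    simp only [supportedPow_one, mul_assoc]
    simp [Matrix.trace, Matrix.diagonal_mul]
  have h2 : ‖star V * X * V‖ ≤ ‖X‖ := by
    have hV1 := norm_le_one_of_mem_unitaryGroup hV
    have hV2 : ‖star V‖ ≤ 1 := by rwa [norm_star]
    calc ‖star V * X * V‖ ≤ ‖star V‖ * ‖X‖ * ‖V‖ :=
        (norm_mul_le _ _).trans (mul_le_mul_of_nonneg_right (norm_mul_le _ _) (norm_nonneg _))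
      _ ≤ 1 * ‖X‖ * 1 := by gcongr
      _ = ‖X‖ := by ring
  rw [h1, Finset.sum_mul]
  refine (norm_sum_le _ _).trans (Finset.sum_le_sum fun k _ => ?_)
  rw [norm_mul, Complex.norm_real, Real.norm_of_nonneg (ht k)]
  exact mul_le_mul_of_nonneg_left ((norm_entry_le _ _ _).trans h2) (ht k)

theorem differentiable_prod_ofFn {m : ℕ} {f : Fin m → ℂ → Matrix n n ℂ}
    (hf : ∀ i, Differentiable ℂ (f i)) :
    Differentiable ℂ fun z => (List.ofFn fun i => f i z).prod := by
  induction m with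
  | zero => simp
  | succ m ih =>
    simp only [List.ofFn_succ, List.prod_cons]
    exact (hf 0).mul (ih fun i => hf i.succ)

theorem norm_prod_ofFn_le {m : ℕ} (f : Fin m → Matrix n n ℂ) :
    ‖(List.ofFn f).prod‖ ≤ ∏ i, ‖f i‖ := by
  induction m with
  | zero => simpa using norm_matrix_one_le
  | succ m ih =>
    rw [List.ofFn_succ, List.prod_cons, Fin.prod_univ_succ]
    exact (norm_mul_le _ _).trans (mul_le_mul_of_nonneg_left (ih _) (norm_nonneg _))

/-- The vertices of the simplex of exponents: a single factor carries a trace bound and all others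
are contractions. -/
theorem norm_trace_prod_ofFn_mul_le {m : ℕ} {B : Fin m → Matrix n n ℂ} (C : Fin m → Matrix n n ℂ)
    {i : Fin m} {T : ℝ} (hT : 0 ≤ T) (hi : ∀ X, ‖(B i * X).trace‖ ≤ T * ‖X‖)
    (hB : ∀ j, j ≠ i → ‖B j‖ ≤ 1) (X : Matrix n n ℂ) :
    ‖((List.ofFn fun j => B j * C j).prod * X).trace‖ ≤ (∏ j, ‖C j‖) * T * ‖X‖ := by
  induction m generalizing X with
  | zero => exact i.elim0
  | succ m ih =>
    rw [List.ofFn_succ, List.prod_cons, Fin.prod_univ_succ]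
    induction i using Fin.cases with
    | zero =>
      have h1 : ‖(List.ofFn fun j : Fin m => B j.succ * C j.succ).prod‖ ≤
          ∏ j : Fin m, ‖C j.succ‖ := by
        refine (norm_prod_ofFn_le _).trans
          (Finset.prod_le_prod (fun j _ => norm_nonneg _) fun j _ => ?_)
        exact (norm_mul_le _ _).trans
          (mul_le_of_le_one_left (norm_nonneg _) (hB _ (Fin.succ_ne_zero j)))
      rw [mul_assoc, mul_assoc]
      refine (hi _).trans ?_
      calc T * ‖C 0 * ((List.ofFn fun j : Fin m => B j.succ * C j.succ).prod * X)‖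
          ≤ T * (‖C 0‖ * ((∏ j : Fin m, ‖C j.succ‖) * ‖X‖)) := by
            refine mul_le_mul_of_nonneg_left ((norm_mul_le _ _).trans ?_) hT
            refine mul_le_mul_of_nonneg_left ((norm_mul_le _ _).trans ?_) (norm_nonneg _)
            exact mul_le_mul_of_nonneg_right h1 (norm_nonneg _)
        _ = _ := by ring
    | succ i =>
      rw [mul_assoc, Matrix.trace_mul_comm, mul_assoc]
      have h0 := ih (B := fun j => B j.succ) (fun j => C j.succ) hi
        (fun j hj => hB _ fun h => hj (Fin.succ_injective _ h)) (X * (B 0 * C 0))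
      refine h0.trans ?_
      have h1 : ‖X * (B 0 * C 0)‖ ≤ ‖X‖ * ‖C 0‖ := by
        refine (norm_mul_le _ _).trans (mul_le_mul_of_nonneg_left ?_ (norm_nonneg _))
        exact (norm_mul_le _ _).trans
          (mul_le_of_le_one_left (norm_nonneg _) (hB _ (Fin.succ_ne_zero i).symm))
      calc (∏ j : Fin m, ‖C j.succ‖) * T * ‖X * (B 0 * C 0)‖
          ≤ (∏ j : Fin m, ‖C j.succ‖) * T * (‖X‖ * ‖C 0‖) := by gcongr
        _ = _ := by ring

theorem norm_spectralPow_le {V : Matrix n n ℂ} (hV : V ∈ Matrix.unitaryGroup n ℂ) {t : n → ℝ}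
    (ht : ∀ k, 0 ≤ t k) {z : ℂ} {r : ℝ} (hz : 0 ≤ z.re) (hr : z.re ≤ r) :
    ‖spectralPow V t z‖ ≤ (1 + ∑ k, t k) ^ r := by
  have hs : 0 ≤ ∑ k, t k := Finset.sum_nonneg fun k _ => ht k
  refine norm_conj_diagonal_le hV (by positivity) fun k => ?_
  unfold supportedPow
  split_ifs with h
  · rw [norm_zero]
    positivity
  · rw [Complex.norm_cpow_eq_rpow_re_of_pos ((ht k).lt_of_ne' h)]
    have h1 : t k ≤ 1 + ∑ k, t k := by
      linarith [Finset.single_le_sum (f := t) (fun k _ => ht k) (Finset.mem_univ k)]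
    exact (Real.rpow_le_rpow (ht k) h1 hz).trans
      (Real.rpow_le_rpow_of_exponent_le (by linarith) hr)

/-- Hölder's inequality for the trace of a product. The exponents for which it holds form a convex
set by Hadamard's three lines theorem, since imaginary powers are contractions and can be absorbed
into the `C i`; and it holds at the vertices of the simplex. -/
theorem norm_trace_prod_spectralPow_le {m : ℕ} {V : Fin m → Matrix n n ℂ}
    (hV : ∀ i, V i ∈ Matrix.unitaryGroup n ℂ) {t : Fin m → n → ℝ} (ht : ∀ i k, 0 ≤ t i k)
    (hT : ∀ i, 0 < ∑ k, t i k) {e : Fin m → ℝ} (he : e ∈ stdSimplex ℝ (Fin m))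
    (C : Fin m → Matrix n n ℂ) :
    ‖(List.ofFn fun i => spectralPow (V i) (t i) (e i) * C i).prod.trace‖ ≤
      (∏ i, ‖C i‖) * ∏ i, (∑ k, t i k) ^ e i := by
  let S : Set (Fin m → ℝ) := {e | (∀ i, 0 ≤ e i) ∧ ∀ C : Fin m → Matrix n n ℂ,
    ‖(List.ofFn fun i => spectralPow (V i) (t i) (e i) * C i).prod.trace‖ ≤
      (∏ i, ‖C i‖) * ∏ i, (∑ k, t i k) ^ e i}
  have hS : Convex ℝ S := by
    rintro x ⟨hx0, hx⟩ y ⟨hy0, hy⟩ s r hs hr hsr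
    refine ⟨fun i => by
      have := hx0 i; have := hy0 i
      simp only [Pi.add_apply, Pi.smul_apply, smul_eq_mul]
      positivity, fun C => ?_⟩
    obtain rfl : s = 1 - r := by linarith
    -- the exponents along the complex line through `x` (at `0`) and `y` (at `1`)
    let ℓ : ℂ → Fin m → ℂ := fun z i => x i + z * (y i - x i)
    let f : ℂ → ℂ := fun z =>
      (List.ofFn fun i => spectralPow (V i) (t i) (ℓ z i) * C i).prod.trace
    have hre : ∀ z i, (ℓ z i).re = (1 - z.re) * x i + z.re * y i := by
      intro z i
      simp [ℓ]
      ring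
    have hfd : Differentiable ℂ f := by
      have h1 : Differentiable ℂ fun z =>
          (List.ofFn fun i => spectralPow (V i) (t i) (ℓ z i) * C i).prod := by
        refine differentiable_prod_ofFn fun i => ?_
        have h2 : Differentiable ℂ fun z => ℓ z i := by
          simp only [ℓ]
          fun_prop
        exact ((differentiable_spectralPow (V i) (t i)).comp h2).mul_const (C i)
      exact (LinearMap.toContinuousLinearMap
        (Matrix.traceLinearMap n ℂ ℂ)).differentiable.comp h1
    have hbdd : BddAbove ((norm ∘ f) '' HadamardThreeLines.verticalClosedStrip 0 1) := by
      refine ⟨Fintype.card n * ∏ i, ((1 + ∑ k, t i k) ^ (x i + y i) * ‖C i‖), ?_⟩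
      rintro _ ⟨z, hz, rfl⟩
      obtain ⟨hz0, hz1⟩ : 0 ≤ z.re ∧ z.re ≤ 1 := hz
      refine (norm_trace_le _).trans (mul_le_mul_of_nonneg_left ?_ (Nat.cast_nonneg _))
      refine (norm_prod_ofFn_le _).trans
        (Finset.prod_le_prod (fun i _ => norm_nonneg _) fun i _ => ?_)
      refine (norm_mul_le _ _).trans (mul_le_mul_of_nonneg_right ?_ (norm_nonneg _))
      have h1 := hx0 i
      have h2 := hy0 i
      refine norm_spectralPow_le (hV i) (ht i) ?_ ?_
      · rw [hre]
        have : 0 ≤ 1 - z.re := by linarith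
        positivity
      · rw [hre]
        nlinarith
    have hedge : ∀ (u : Fin m → ℝ) (w : Fin m → ℂ), (∀ i, (w i).re = 0) →
        (∀ C : Fin m → Matrix n n ℂ,
          ‖(List.ofFn fun i => spectralPow (V i) (t i) (u i) * C i).prod.trace‖ ≤
          (∏ i, ‖C i‖) * ∏ i, (∑ k, t i k) ^ u i) →
        ‖(List.ofFn fun i => spectralPow (V i) (t i) (u i + w i) * C i).prod.trace‖ ≤
          (∏ i, ‖C i‖) * ∏ i, (∑ k, t i k) ^ u i := by
      intro u w hw hu
      simp only [spectralPow_add (hV _), mul_assoc]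
      refine (hu fun i => spectralPow (V i) (t i) (w i) * C i).trans ?_
      refine mul_le_mul_of_nonneg_right (Finset.prod_le_prod (fun i _ => norm_nonneg _)
        fun i _ => ?_) (Finset.prod_nonneg fun i _ => Real.rpow_nonneg (hT i).le _)
      exact (norm_mul_le _ _).trans (mul_le_of_le_one_left (norm_nonneg _)
        (norm_spectralPow_le_one (hV i) (ht i) (hw i)))
    have h0 : ∀ z ∈ re ⁻¹' {(0 : ℝ)}, ‖f z‖ ≤ (∏ i, ‖C i‖) * ∏ i, (∑ k, t i k) ^ x i := by
      intro z hz
      have hz' : z.re = 0 := hz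
      exact hedge x (fun i => z * (y i - x i)) (fun i => by simp [hz']) hx
    have h1 : ∀ z ∈ re ⁻¹' {(1 : ℝ)}, ‖f z‖ ≤ (∏ i, ‖C i‖) * ∏ i, (∑ k, t i k) ^ y i := by
      intro z hz
      have hz' : z.re = 1 := hz
      have hℓ : ∀ i, ℓ z i = y i + (z - 1) * (y i - x i) := fun i => by
        simp only [ℓ]
        ring
      simp only [f, hℓ]
      exact hedge y (fun i => (z - 1) * (y i - x i)) (fun i => by simp [hz']) hy
    have hmain := HadamardThreeLines.norm_le_interp_of_mem_verticalClosedStrip' zero_lt_one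
      (z := (r : ℂ)) (show (r : ℂ) ∈ HadamardThreeLines.verticalClosedStrip 0 1 from
        ⟨by simpa using hr, by simpa using by linarith⟩) hfd.diffContOnCl hbdd h0 h1
    have hexp : ∀ i, ℓ r i = (((1 - r) • x + r • y) i : ℝ) := fun i => by
      simp only [ℓ, Pi.add_apply, Pi.smul_apply, smul_eq_mul]
      push_cast
      ring
    simp only [f, hexp, ofReal_re, sub_zero, div_one] at hmain
    refine hmain.trans_eq ?_
    have hC : 0 ≤ ∏ i, ‖C i‖ := Finset.prod_nonneg fun i _ => norm_nonneg _
    have hP : ∀ u : Fin m → ℝ, 0 ≤ ∏ i, (∑ k, t i k) ^ u i := fun u =>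
      Finset.prod_nonneg fun i _ => Real.rpow_nonneg (hT i).le _
    rw [Real.mul_rpow hC (hP x), Real.mul_rpow hC (hP y), mul_mul_mul_comm,
      ← Real.rpow_add_of_nonneg hC hs hr, sub_add_cancel, Real.rpow_one,
      ← Real.finsetProd_rpow _ _ fun i _ => Real.rpow_nonneg (hT i).le _,
      ← Real.finsetProd_rpow _ _ fun i _ => Real.rpow_nonneg (hT i).le _,
      ← Finset.prod_mul_distrib]
    congr 1
    refine Finset.prod_congr rfl fun i _ => ?_
    rw [← Real.rpow_mul (hT i).le, ← Real.rpow_mul (hT i).le, ← Real.rpow_add (hT i)]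
    congr 1
    simp only [Pi.add_apply, Pi.smul_apply, smul_eq_mul]
    ring
  have hvertex : Set.range (fun i : Fin m => (Pi.single i 1 : Fin m → ℝ)) ⊆ S := by
    rintro _ ⟨i, rfl⟩
    refine ⟨fun j => ?_, fun C => ?_⟩
    · by_cases h : j = i
      · subst h; simp
      · simp [h]
    · have h1 := norm_trace_prod_ofFn_mul_le
        (B := fun j => spectralPow (V j) (t j) ((Pi.single i 1 : Fin m → ℝ) j)) C (i := i)
        (hT i).le (fun X => by
          simpa using norm_trace_spectralPow_one_mul_le (hV i) (ht i) X)
        (fun j hj => norm_spectralPow_le_one (hV j) (ht j) (by simp [hj])) 1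
      rw [mul_one] at h1
      refine h1.trans ((mul_le_of_le_one_right ?_ norm_matrix_one_le).trans_eq ?_)
      · exact mul_nonneg (Finset.prod_nonneg fun j _ => norm_nonneg _) (hT i).le
      · congr 1
        rw [Finset.prod_eq_single i (fun j _ hj => by simp [hj]) (by simp)]
        simp
  have := convexHull_min hvertex hS
  rw [convexHull_rangle_single_eq_stdSimplex] at this
  exact (this he).2 C

end Hoelder

/-! ### Schatten norms of perturbed powers -/

section Schatten

variable {n : Type*} [Fintype n] [DecidableEq n]

theorem trace_conj_diagonal {V : Matrix n n ℂ} (hV : V ∈ Matrix.unitaryGroup n ℂ) (d : n → ℂ) :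
    (V * Matrix.diagonal d * star V).trace = ∑ k, d k := by
  rw [mul_assoc, Matrix.trace_mul_comm, mul_assoc, (Matrix.mem_unitaryGroup_iff').1 hV, mul_one,
    Matrix.trace_diagonal]

theorem star_conj_diagonal (V : Matrix n n ℂ) (d : n → ℝ) :
    star (V * Matrix.diagonal (fun k => (d k : ℂ)) * star V) =
      V * Matrix.diagonal (fun k => (d k : ℂ)) * star V := by
  rw [star_mul, star_mul, star_star, Matrix.star_eq_conjTranspose (Matrix.diagonal _),
    Matrix.diagonal_conjTranspose, mul_assoc]
  congr 3
  funext k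
  simp

theorem trace_cfc_conj_diagonal {V : Matrix n n ℂ} (hV : V ∈ Matrix.unitaryGroup n ℂ) (μ : n → ℝ)
    (f : ℝ → ℝ) :
    (cfc f (V * Matrix.diagonal (fun k => (μ k : ℂ)) * star V)).trace = ∑ k, (f (μ k) : ℂ) := by
  set A := V * Matrix.diagonal (fun k => (μ k : ℂ)) * star V with hA
  have hAh : A.IsHermitian := star_conj_diagonal V μ
  have hroots : Multiset.map (fun k => (hAh.eigenvalues k : ℂ)) Finset.univ.val =
      Multiset.map (fun k => (μ k : ℂ)) Finset.univ.val := by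
    have h1 := hAh.roots_charpoly_eq_eigenvalues
    have h2 : A.charpoly = (Matrix.diagonal fun k => (μ k : ℂ)).charpoly := by
      rw [hA, Matrix.charpoly_mul_comm, ← mul_assoc, (Matrix.mem_unitaryGroup_iff').1 hV, one_mul]
    have h3 := Polynomial.roots_multiset_prod_X_sub_C
      (Multiset.map (fun k => (μ k : ℂ)) Finset.univ.val)
    rw [Multiset.map_map] at h3
    rw [h2, Matrix.charpoly_diagonal] at h1
    exact h1.symm.trans h3
  have h3 := congrArg (fun s => (Multiset.map (fun z : ℂ => (f z.re : ℂ)) s).sum) hroots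
  simp only [Multiset.map_map, Function.comp_def, Complex.ofReal_re] at h3
  rw [hAh.cfc_eq, Matrix.IsHermitian.cfc]
  have := trace_conj_diagonal hAh.eigenvectorUnitary.2 (fun k => (f (hAh.eigenvalues k) : ℂ))
  refine this.trans h3

theorem schattenNorm_eq_of_star_mul_self {V O : Matrix n n ℂ} (hV : V ∈ Matrix.unitaryGroup n ℂ)
    {μ : n → ℝ} (h : star O * O = V * Matrix.diagonal (fun k => (μ k : ℂ)) * star V)
    {p : ℝ≥0∞} (hp : 1 ≤ p) (hp' : p ≠ ∞) :
    schattenNorm p O = (∑ k, μ k ^ (p.toReal / 2)) ^ (1 / p.toReal) := by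
  have hr : 0 < p.toReal := ENNReal.toReal_pos (zero_lt_one.trans_le hp).ne' hp'
  have h1 : CFC.rpow (CFC.abs O) p.toReal = (star O * O) ^ (p.toReal / 2) := by
    have := CFC.rpow_sqrt_nnreal (a := star O * O) (x := p.toNNReal)
      (star_mul_self_nonneg O)
    exact this
  rw [schattenNorm, if_neg hp', h1, CFC.rpow_eq_cfc_real (star_mul_self_nonneg O), h, trace_cfc_conj_diagonal hV]
  congr 1
  simp

theorem conj_diagonal_mul {V : Matrix n n ℂ} (hV : V ∈ Matrix.unitaryGroup n ℂ) (d d' : n → ℂ) :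
    V * Matrix.diagonal d * star V * (V * Matrix.diagonal d' * star V) =
      V * Matrix.diagonal (fun k => d k * d' k) * star V := by
  rw [← Matrix.diagonal_mul_diagonal]
  calc _ = V * Matrix.diagonal d * (star V * V) * Matrix.diagonal d' * star V := by
        simp only [mul_assoc]
    _ = _ := by rw [(Matrix.mem_unitaryGroup_iff').1 hV, mul_one, mul_assoc V]

theorem conj_diagonal_pow {V : Matrix n n ℂ} (hV : V ∈ Matrix.unitaryGroup n ℂ) (d : n → ℝ)
    (N : ℕ) : (V * Matrix.diagonal (fun k => (d k : ℂ)) * star V) ^ N =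
      V * Matrix.diagonal (fun k => ((d k ^ N : ℝ) : ℂ)) * star V := by
  induction N with
  | zero => simp [(Matrix.mem_unitaryGroup_iff).1 hV]
  | succ N ih =>
    rw [pow_succ, ih, conj_diagonal_mul hV]
    simp [pow_succ]

theorem exists_unitary_eq_conj_diagonal {A : Matrix n n ℂ} (hA : A.IsHermitian) :
    ∃ V ∈ Matrix.unitaryGroup n ℂ, A = V * Matrix.diagonal (fun k => (hA.eigenvalues k : ℂ)) *
      star V :=
  ⟨hA.eigenvectorUnitary, hA.eigenvectorUnitary.2, hA.spectral_theorem⟩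

/-- The duality of the Schatten norms, on the side used here: `tr |O| ^ r` is the trace of `O`
against a positive semidefinite matrix with eigenvalues `|O| ^ (r - 1)` and a contraction. -/
theorem exists_dual_of_star_mul_self {V O : Matrix n n ℂ} (hV : V ∈ Matrix.unitaryGroup n ℂ)
    {μ : n → ℝ} (hμ : ∀ k, 0 ≤ μ k)
    (h : star O * O = V * Matrix.diagonal (fun k => (μ k : ℂ)) * star V) {r : ℝ} (hr : 0 < r) :
    ∃ C : Matrix n n ℂ, ‖C‖ ≤ 1 ∧
      (spectralPow V (fun k => μ k ^ (r / 2)) (((r - 1) / r : ℝ) : ℂ) * C * O).trace =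
        ((∑ k, μ k ^ (r / 2) : ℝ) : ℂ) := by
  let d : n → ℝ := fun k => (Real.sqrt (μ k))⁻¹
  let D : Matrix n n ℂ := V * Matrix.diagonal (fun k => (d k : ℂ)) * star V
  refine ⟨D * star O, ?_, ?_⟩
  · have h1 : D * star O * star (D * star O) =
        V * Matrix.diagonal (fun k => (d k : ℂ) * (μ k * d k)) * star V := by
      calc D * star O * star (D * star O) = D * ((star O * O) * D) := by
            rw [star_mul, star_star, star_conj_diagonal]
            simp only [D, mul_assoc]
        _ = _ := by rw [h, conj_diagonal_mul hV, conj_diagonal_mul hV]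
    have h2 : ‖D * star O * star (D * star O)‖ ≤ 1 := by
      rw [h1]
      refine norm_conj_diagonal_le hV zero_le_one fun k => ?_
      have h3 : d k * (μ k * d k) = Real.sqrt (μ k) * (Real.sqrt (μ k))⁻¹ *
          (Real.sqrt (μ k) * (Real.sqrt (μ k))⁻¹) := by
        conv_lhs => rw [← Real.mul_self_sqrt (hμ k)]
        simp only [d]
        ring
      rw [← Complex.ofReal_mul, ← Complex.ofReal_mul, h3, Complex.norm_real]
      by_cases hk : Real.sqrt (μ k) = 0
      · simp [hk]
      · simp [mul_inv_cancel₀ hk]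
    rw [CStarRing.norm_self_mul_star] at h2
    nlinarith [norm_nonneg (D * star O)]
  · rw [mul_assoc, mul_assoc D, h, spectralPow, conj_diagonal_mul hV, conj_diagonal_mul hV,
      trace_conj_diagonal hV]
    rw [Complex.ofReal_sum]
    refine Finset.sum_congr rfl fun k _ => ?_
    rcases (hμ k).eq_or_lt with hk | hk
    · have hr2 : r / 2 ≠ 0 := by positivity
      simp [← hk, Real.zero_rpow hr2]
    · rw [supportedPow_ofReal (Real.rpow_pos_of_pos hk _), ← Complex.ofReal_mul,
        ← Complex.ofReal_mul]
      congr 1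
      have h4 : d k * μ k = μ k ^ (1 / 2 : ℝ) := by
        rw [← Real.sqrt_eq_rpow]
        have h5 := Real.mul_self_sqrt hk.le
        have h6 : Real.sqrt (μ k) ≠ 0 := (Real.sqrt_pos.2 hk).ne'
        simp only [d]
        field_simp
        nlinarith
      rw [h4, ← Real.rpow_mul hk.le, ← Real.rpow_add hk]
      congr 1
      field_simp
      ring

open scoped ComplexOrder in
theorem exists_unitary_star_mul_self (O : Matrix n n ℂ) :
    ∃ V ∈ Matrix.unitaryGroup n ℂ, ∃ μ : n → ℝ, (∀ k, 0 ≤ μ k) ∧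
      star O * O = V * Matrix.diagonal (fun k => (μ k : ℂ)) * star V := by
  have hO : (star O * O).PosSemidef := Matrix.posSemidef_conjTranspose_mul_self O
  obtain ⟨V, hV, hVO⟩ := exists_unitary_eq_conj_diagonal hO.isHermitian
  exact ⟨V, hV, _, hO.eigenvalues_nonneg, hVO⟩

theorem schattenNorm_nonneg {p : ℝ≥0∞} (hp : 1 ≤ p) (O : Matrix n n ℂ) : 0 ≤ schattenNorm p O := by
  rcases eq_or_ne p ∞ with rfl | hp'
  · simp [schattenNorm]
  · obtain ⟨V, hV, μ, hμ, h⟩ := exists_unitary_star_mul_self O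
    rw [schattenNorm_eq_of_star_mul_self hV h hp hp']
    exact Real.rpow_nonneg (Finset.sum_nonneg fun k _ => Real.rpow_nonneg (hμ k) _) _

/-- Hölder's inequality for Schatten norms, in the form needed: a sum of words
`K C₁ K C₂ ⋯ K C_N` is bounded by the norm of `K ^ N` and the operator norms of the `C i`,
uniformly in the Schatten index. -/
theorem schattenNorm_sum_prod_le {U : Matrix n n ℂ} (hU : U ∈ Matrix.unitaryGroup n ℂ) {κ : n → ℝ}
    (hκ : ∀ k, 0 < κ k) {N : ℕ} (hN : 0 < N) {ι : Type*} (s : Finset ι)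
    (C : ι → Fin N → Matrix n n ℂ) {K : Matrix n n ℂ}
    (hK : K = U * Matrix.diagonal (fun k => (κ k : ℂ)) * star U) {p : ℝ≥0∞} (hp : 1 ≤ p) :
    schattenNorm p (∑ i ∈ s, (List.ofFn fun j => K * C i j).prod) ≤
      (∑ i ∈ s, ∏ j, ‖C i j‖) * schattenNorm p (K ^ N) := by
  have hNr : (0 : ℝ) < N := by exact_mod_cast hN
  have hKN : K ^ N = U * Matrix.diagonal (fun k => ((κ k ^ N : ℝ) : ℂ)) * star U := by
    rw [hK, conj_diagonal_pow hU]
  rcases eq_or_ne p ∞ with rfl | hp'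
  · simp only [schattenNorm, if_true]
    -- the operator norm of the positive matrix `K` satisfies `‖K‖ ^ N ≤ ‖K ^ N‖`
    have hnorm : ‖K‖ ^ N ≤ ‖K ^ N‖ := by
      have hle : ∀ k, κ k ≤ ‖K ^ N‖ ^ (1 / (N : ℝ)) := by
        intro k
        have h1 : star U * K ^ N * U = Matrix.diagonal (fun k => ((κ k ^ N : ℝ) : ℂ)) := by
          rw [hKN]
          calc _ = (star U * U) * Matrix.diagonal (fun k => ((κ k ^ N : ℝ) : ℂ)) *
                (star U * U) := by simp only [mul_assoc]
            _ = _ := by rw [(Matrix.mem_unitaryGroup_iff').1 hU, one_mul, mul_one]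
        have h2 : κ k ^ N ≤ ‖K ^ N‖ := by
          have h3 := norm_entry_le (star U * K ^ N * U) k k
          rw [h1, Matrix.diagonal_apply_eq, Complex.norm_real,
            Real.norm_of_nonneg (pow_nonneg (hκ k).le _), ← h1] at h3
          refine h3.trans ?_
          have hU1 := norm_le_one_of_mem_unitaryGroup hU
          have hU2 : ‖star U‖ ≤ 1 := by rwa [norm_star]
          calc ‖star U * K ^ N * U‖ ≤ ‖star U‖ * ‖K ^ N‖ * ‖U‖ := (norm_mul_le _ _).trans
                (mul_le_mul_of_nonneg_right (norm_mul_le _ _) (norm_nonneg _))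
            _ ≤ 1 * ‖K ^ N‖ * 1 := by gcongr
            _ = _ := by ring
        calc κ k = (κ k ^ N) ^ (1 / (N : ℝ)) := by
              rw [one_div, Real.pow_rpow_inv_natCast (hκ k).le hN.ne']
          _ ≤ _ := Real.rpow_le_rpow (pow_nonneg (hκ k).le _) h2 (by positivity)
      have h4 : ‖K‖ ≤ ‖K ^ N‖ ^ (1 / (N : ℝ)) := by
        rw [hK] at hle ⊢
        refine norm_conj_diagonal_le hU (by positivity) fun k => ?_
        rw [Complex.norm_real, Real.norm_of_nonneg (hκ k).le]
        exact hle k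
      calc ‖K‖ ^ N ≤ (‖K ^ N‖ ^ (1 / (N : ℝ))) ^ N := pow_le_pow_left₀ (norm_nonneg _) h4 _
        _ = _ := by rw [one_div, Real.rpow_inv_natCast_pow (norm_nonneg _) hN.ne']
    rw [Finset.sum_mul]
    refine (norm_sum_le _ _).trans (Finset.sum_le_sum fun i _ => ?_)
    calc ‖(List.ofFn fun j => K * C i j).prod‖ ≤ ∏ j, ‖K * C i j‖ := norm_prod_ofFn_le _
      _ ≤ ∏ j, (‖K‖ * ‖C i j‖) :=
          Finset.prod_le_prod (fun j _ => norm_nonneg _) fun j _ => norm_mul_le _ _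
      _ = (∏ j, ‖C i j‖) * ‖K‖ ^ N := by
          rw [Finset.prod_mul_distrib]
          simp [mul_comm]
      _ ≤ _ := mul_le_mul_of_nonneg_left hnorm (Finset.prod_nonneg fun j _ => norm_nonneg _)
  · set r := p.toReal with hr_def
    have hr1 : 1 ≤ r := by
      have := ENNReal.toReal_mono hp' hp
      simpa using this
    have hr : 0 < r := by linarith
    set O := ∑ i ∈ s, (List.ofFn fun j => K * C i j).prod with hO
    obtain ⟨V, hV, μ, hμ, hVO⟩ := exists_unitary_star_mul_self O
    set T₀ := ∑ k, μ k ^ (r / 2) with hT₀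
    set T₁ := ∑ k, κ k ^ (N * r) with hT₁
    have hKK : star (K ^ N) * K ^ N =
        U * Matrix.diagonal (fun k => (((κ k ^ N) ^ 2 : ℝ) : ℂ)) * star U := by
      rw [hKN, star_conj_diagonal, conj_diagonal_mul hU]
      simp [pow_two]
    rw [schattenNorm_eq_of_star_mul_self hV hVO hp hp',
      schattenNorm_eq_of_star_mul_self hU hKK hp hp', ← hr_def, ← hT₀]
    have hT₁' : ∑ k, ((κ k ^ N) ^ 2) ^ (r / 2) = T₁ := by
      refine Finset.sum_congr rfl fun k _ => ?_
      rw [← pow_mul, ← Real.rpow_natCast, ← Real.rpow_mul (hκ k).le]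
      congr 1
      push_cast
      ring
    rw [hT₁']
    have hη : 0 ≤ ∑ i ∈ s, ∏ j, ‖C i j‖ :=
      Finset.sum_nonneg fun i _ => Finset.prod_nonneg fun j _ => norm_nonneg _
    have hT₁0 : 0 ≤ T₁ := Finset.sum_nonneg fun k _ => Real.rpow_nonneg (hκ k).le _
    have hT₀0 : 0 ≤ T₀ := Finset.sum_nonneg fun k _ => Real.rpow_nonneg (hμ k) _
    rcases hT₀0.eq_or_lt with h0 | h0
    · rw [← h0, Real.zero_rpow (by positivity)]
      positivity
    have hne : Nonempty n := by
      by_contra hne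
      rw [not_nonempty_iff] at hne
      simp [hT₀] at h0
    have hT₁pos : 0 < T₁ := Finset.sum_pos (fun k _ => Real.rpow_pos_of_pos (hκ k) _)
      Finset.univ_nonempty
    obtain ⟨C₀, hC₀, htr⟩ := exists_dual_of_star_mul_self hV hμ hVO hr
    have hKpow : spectralPow U (fun k => κ k ^ (N * r)) ((1 / (N * r) : ℝ) : ℂ) = K := by
      rw [spectralPow, hK]
      congr 3
      funext k
      rw [supportedPow_ofReal (Real.rpow_pos_of_pos (hκ k) _), ← Real.rpow_mul (hκ k).le,
        mul_one_div_cancel (by positivity), Real.rpow_one]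
    -- Hölder's inequality with exponent `(r - 1) / r` on the dual matrix and `1 / (N r)` on each `K`
    have hterm : ∀ i, ‖(spectralPow V (fun k => μ k ^ (r / 2)) (((r - 1) / r : ℝ) : ℂ) * C₀ *
        (List.ofFn fun j => K * C i j).prod).trace‖ ≤
        (∏ j, ‖C i j‖) * (T₀ ^ ((r - 1) / r) * T₁ ^ (1 / r)) := by
      intro i
      have h := norm_trace_prod_spectralPow_le (m := N + 1)
        (V := Fin.cons V fun _ => U) (t := Fin.cons (fun k => μ k ^ (r / 2))
          fun _ k => κ k ^ (N * r)) (e := Fin.cons ((r - 1) / r) fun _ => 1 / (N * r))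
        (fun j => by
          refine Fin.cases ?_ (fun j => ?_) j
          · exact hV
          · exact hU)
        (fun j => by
          refine Fin.cases ?_ (fun j => ?_) j
          · exact fun k => Real.rpow_nonneg (hμ k) _
          · exact fun k => Real.rpow_nonneg (hκ k).le _)
        (fun j => by
          refine Fin.cases ?_ (fun j => ?_) j
          · exact h0
          · exact hT₁pos)
        ⟨fun j => by
          refine Fin.cases ?_ (fun j => ?_) j
          · exact div_nonneg (by linarith) hr.le
          · simp only [Fin.cons_succ]
            positivity, by
          rw [Fin.sum_univ_succ]
          simp only [Fin.cons_zero, Fin.cons_succ, Finset.sum_const, Finset.card_univ,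
            Fintype.card_fin, nsmul_eq_mul]
          field_simp
          ring⟩
        (Fin.cons C₀ (C i))
      simp only [List.ofFn_succ, Fin.cons_zero, Fin.cons_succ, List.prod_cons,
        Fin.prod_univ_succ, hKpow, Finset.prod_const, Finset.card_univ, Fintype.card_fin] at h
      refine h.trans ?_
      have h5 : (T₁ ^ (1 / (N * r))) ^ N = T₁ ^ (1 / r) := by
        rw [← Real.rpow_natCast, ← Real.rpow_mul hT₁0]
        congr 1
        field_simp
      rw [← hT₁, ← hT₀, h5]
      refine mul_le_mul_of_nonneg_right ?_ (by positivity)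
      exact mul_le_of_le_one_left (Finset.prod_nonneg fun j _ => norm_nonneg _) hC₀
    have hsum : T₀ ≤ (∑ i ∈ s, ∏ j, ‖C i j‖) * (T₀ ^ ((r - 1) / r) * T₁ ^ (1 / r)) := by
      calc T₀ = ‖((T₀ : ℝ) : ℂ)‖ := by rw [Complex.norm_real, Real.norm_of_nonneg hT₀0]
        _ = ‖∑ i ∈ s, (spectralPow V (fun k => μ k ^ (r / 2)) (((r - 1) / r : ℝ) : ℂ) * C₀ *
            (List.ofFn fun j => K * C i j).prod).trace‖ := by
            rw [← htr, hO, Finset.mul_sum, Matrix.trace_sum]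
        _ ≤ _ := by
            rw [Finset.sum_mul]
            exact (norm_sum_le _ _).trans (Finset.sum_le_sum fun i _ => hterm i)
    have hsplit : T₀ = T₀ ^ (1 / r) * T₀ ^ ((r - 1) / r) := by
      rw [← Real.rpow_add h0, ← add_div, add_sub_cancel, div_self hr.ne', Real.rpow_one]
    have hpos : 0 < T₀ ^ ((r - 1) / r) := Real.rpow_pos_of_pos h0 _
    refine le_of_mul_le_mul_right ?_ hpos
    rw [← hsplit]
    linarith

theorem sum_prod_ofFn_telescope {R : Type*} [Ring R] (K E : R) (N : ℕ) :
    ∑ k : Fin N, (List.ofFn fun j : Fin N =>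
      K * if j < k then 1 + E else if j = k then E else 1).prod = (K * (1 + E)) ^ N - K ^ N := by
  induction N with
  | zero => simp
  | succ N ih =>
    rw [Fin.sum_univ_succ]
    simp only [List.ofFn_succ, List.prod_cons, Fin.succ_lt_succ_iff, Fin.succ_inj,
      Fin.succ_pos, if_true, if_false, Fin.not_lt_zero, Fin.succ_ne_zero, mul_one,
      List.ofFn_const, List.prod_replicate]
    rw [← Finset.mul_sum, ih, pow_succ', pow_succ']
    noncomm_ring

theorem sum_prod_norm_le {E : Matrix n n ℂ} {δ : ℝ} (hE : ‖E‖ ≤ δ) (N : ℕ) :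
    ∑ k : Fin N, ∏ j : Fin N, ‖if j < k then 1 + E else if j = k then E else 1‖ ≤
      (1 + δ) ^ N - 1 := by
  have htel := sum_prod_ofFn_telescope (1 : ℝ) δ N
  simp only [one_mul, one_pow, List.prod_ofFn] at htel
  rw [← htel]
  refine Finset.sum_le_sum fun k _ => Finset.prod_le_prod (fun j _ => norm_nonneg _) fun j _ => ?_
  split_ifs
  · exact (norm_add_le _ _).trans (add_le_add norm_matrix_one_le hE)
  · exact hE
  · exact norm_matrix_one_le

theorem norm_pow_sub_pow_le {K E : Matrix n n ℂ} (hK : ‖K‖ ≤ 1) {δ : ℝ} (hE : ‖E‖ ≤ δ) (N : ℕ) :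
    ‖(K * (1 + E)) ^ N - K ^ N‖ ≤ (1 + δ) ^ N - 1 := by
  rw [← sum_prod_ofFn_telescope]
  refine (norm_sum_le _ _).trans (le_trans (Finset.sum_le_sum fun k _ => ?_)
    (sum_prod_norm_le hE N))
  refine (norm_prod_ofFn_le _).trans
    (Finset.prod_le_prod (fun j _ => norm_nonneg _) fun j _ => ?_)
  exact (norm_mul_le _ _).trans (mul_le_of_le_one_left (norm_nonneg _) hK)

/-- If each factor `K` of `K ^ N` is perturbed to `K (1 + E)`, the relative error in every Schatten
norm is at most `(1 + δ) ^ N - 1`, where `‖E‖ ≤ δ`. -/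
theorem schattenNorm_pow_sub_pow_le {U : Matrix n n ℂ} (hU : U ∈ Matrix.unitaryGroup n ℂ)
    {κ : n → ℝ} (hκ : ∀ k, 0 < κ k) {N : ℕ} (hN : 0 < N) {K : Matrix n n ℂ}
    (hK : K = U * Matrix.diagonal (fun k => (κ k : ℂ)) * star U) {E : Matrix n n ℂ} {δ : ℝ}
    (hE : ‖E‖ ≤ δ) {p : ℝ≥0∞} (hp : 1 ≤ p) :
    schattenNorm p ((K * (1 + E)) ^ N - K ^ N) ≤ ((1 + δ) ^ N - 1) * schattenNorm p (K ^ N) := by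
  rw [← sum_prod_ofFn_telescope]
  refine (schattenNorm_sum_prod_le hU hκ hN Finset.univ
    (fun k j => if j < k then 1 + E else if j = k then E else 1) hK hp).trans ?_
  exact mul_le_mul_of_nonneg_right (sum_prod_norm_le hE N) (schattenNorm_nonneg hp _)

theorem schattenNorm_zero {p : ℝ≥0∞} (hp : 1 ≤ p) :
    schattenNorm p (0 : Matrix n n ℂ) = 0 := by
  rcases eq_or_ne p ∞ with rfl | hp'
  · simp [schattenNorm]
  · have hr : 0 < p.toReal := ENNReal.toReal_pos (zero_lt_one.trans_le hp).ne' hp'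
    rw [schattenNorm_eq_of_star_mul_self (one_mem _) (μ := fun _ => 0) (by simp) hp hp',
      Real.zero_rpow (by positivity), Finset.sum_const_zero, Real.zero_rpow (by positivity)]

theorem schattenNorm_neg (p : ℝ≥0∞) (O : Matrix n n ℂ) :
    schattenNorm p (-O) = schattenNorm p O := by
  rw [schattenNorm, schattenNorm, norm_neg, CFC.abs_neg]

end Schatten

/-! ### Approximating the evolution operators -/

theorem one_add_pow_sub_one_le {n : ℕ} {δ ε : ℝ} (hδ : 0 ≤ δ) (hε0 : 0 ≤ ε) (hε1 : ε ≤ 1)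
    (h : n * δ ≤ ε / 2) : (1 + δ) ^ n - 1 ≤ ε := by
  have h1 : (1 + δ) ^ n ≤ Real.exp (ε / 2) := by
    calc (1 + δ) ^ n ≤ Real.exp δ ^ n := by
          gcongr
          linarith [Real.add_one_le_exp δ]
      _ = Real.exp (n * δ) := (Real.exp_nat_mul δ n).symm
      _ ≤ _ := Real.exp_le_exp.2 h
  have h2 : Real.exp (ε / 2) ≤ 1 / (1 - ε / 2) :=
    Real.exp_bound_div_one_sub_of_interval (by linarith) (by linarith)
  have h3 : 1 / (1 - ε / 2) ≤ 1 + ε := by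
    rw [div_le_iff₀ (by linarith)]
    nlinarith
  linarith

section Exp

variable {n : Type*} [Fintype n] [DecidableEq n]

theorem exp_smul_mul_exp_neg_smul (X : Matrix n n ℂ) (x : ℂ) :
    NormedSpace.exp (x • X) * NormedSpace.exp ((-x) • X) = 1 := by
  rw [← Matrix.exp_add_of_commute _ _ (((Commute.refl X).smul_left x).smul_right (-x)),
    ← add_smul, add_neg_cancel, zero_smul, NormedSpace.exp_zero]

theorem star_exp_smul {X : Matrix n n ℂ} (hX : X.IsHermitian) (x : ℂ) :
    star (NormedSpace.exp (x • X)) = NormedSpace.exp (star x • X) := by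
  rw [Matrix.star_eq_conjTranspose, ← Matrix.exp_conjTranspose, Matrix.conjTranspose_smul, hX.eq]

theorem norm_exp_smul_le_one {X : Matrix n n ℂ} (hX : X.IsHermitian) {x : ℂ} (hx : x.re = 0) :
    ‖NormedSpace.exp (x • X)‖ ≤ 1 := by
  refine norm_le_one_of_mem_unitaryGroup (Matrix.mem_unitaryGroup_iff.2 ?_)
  have h : star x = -x := Complex.ext (by simp [hx]) (by simp)
  rw [star_exp_smul hX, h, exp_smul_mul_exp_neg_smul]

theorem exp_smul_pow (X : Matrix n n ℂ) (z : ℂ) {m : ℕ} (hm : m ≠ 0) :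
    NormedSpace.exp ((z / m) • X) ^ m = NormedSpace.exp (z • X) := by
  have hm' : (m : ℂ) ≠ 0 := by exact_mod_cast hm
  rw [← Matrix.exp_nsmul, ← Nat.cast_smul_eq_nsmul ℂ, smul_smul, mul_div_cancel₀ _ hm']

/-- The exponential of a Hermitian matrix, diagonalized. -/
theorem exists_unitary_exp_eq {X : Matrix n n ℂ} (hX : X.IsHermitian) (x : ℝ) :
    ∃ U ∈ Matrix.unitaryGroup n ℂ, ∃ κ : n → ℝ, (∀ k, 0 < κ k) ∧
      NormedSpace.exp ((x : ℂ) • X) = U * Matrix.diagonal (fun k => (κ k : ℂ)) * star U := by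
  obtain ⟨U, hU, h⟩ := exists_unitary_eq_conj_diagonal hX
  refine ⟨U, hU, fun k => Real.exp (x * hX.eigenvalues k), fun k => Real.exp_pos _, ?_⟩
  have hinv : U⁻¹ = star U := Matrix.inv_eq_left_inv ((Matrix.mem_unitaryGroup_iff').1 hU)
  have hunit : IsUnit U := IsUnit.of_mul_eq_one _ ((Matrix.mem_unitaryGroup_iff).1 hU)
  have h1 : (x : ℂ) • X = U * Matrix.diagonal (fun k => ((x * hX.eigenvalues k : ℝ) : ℂ)) *
      U⁻¹ := by
    conv_lhs => rw [h]
    rw [hinv, ← Matrix.smul_mul, ← Matrix.mul_smul, ← Matrix.diagonal_smul]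
    congr 3
    funext k
    simp
  rw [h1, Matrix.exp_conj _ _ hunit, Matrix.exp_diagonal, hinv]
  congr 3
  funext k
  rw [Pi.coe_exp, ← Complex.exp_eq_exp_ℂ, Complex.ofReal_exp]

end Exp

theorem rateQ0_nonneg {Q C₀ g : ℝ} (hQ : 0 ≤ Q) : 0 ≤ rateQ0 Q C₀ g :=
  le_max_of_le_left (by positivity)

theorem isHermitian_decoupledHamiltonian {a b : Type*} [DecidableEq a] [DecidableEq b]
    {HA : Matrix a a ℂ} {HB : Matrix b b ℂ} (hHA : HA.IsHermitian) (hHB : HB.IsHermitian) :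
    (decoupledHamiltonian HA HB).IsHermitian := by
  rw [Matrix.IsHermitian, decoupledHamiltonian, Matrix.conjTranspose_add,
    Matrix.conjTranspose_kronecker, Matrix.conjTranspose_kronecker, hHA.eq, hHB.eq,
    Matrix.conjTranspose_one, Matrix.conjTranspose_one]

section Steps

variable {a b : Type*} [Fintype a] [DecidableEq a] [Fintype b] [DecidableEq b]

/-- If no step is needed, then the time vanishes or there is no interaction, and the evolution is a
product operator. -/
theorem schmidtRank_exp_le_one_of_rate {HA : Matrix a a ℂ} {HB : Matrix b b ℂ}
    {W : Matrix (a × b) (a × b) ℂ} {V : ℕ → Matrix (a × b) (a × b) ℂ}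
    (hsum : Summable fun j => ‖V j‖) (hV : HasSum V W) {C₀ Q : ℝ} (hC₀ : 1 ≤ C₀) (hQ : 0 ≤ Q)
    {z : ℂ} (hz : ‖z‖ * rateQ0 Q C₀ (∑' j, ‖V j‖) ≤ 0) :
    schmidtRank (NormedSpace.exp (z • (decoupledHamiltonian HA HB + W))) ≤ 1 := by
  have hz' := le_antisymm hz (mul_nonneg (norm_nonneg z) (rateQ0_nonneg hQ))
  rcases mul_eq_zero.1 hz' with h | h
  · rw [norm_eq_zero.1 h, zero_smul, NormedSpace.exp_zero]
    exact schmidtRank_one_le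
  · have h1 : 4 * Real.exp 1 * C₀ * (∑' j, ‖V j‖) ≤ 0 := h ▸ le_max_right _ _
    have h2 : 0 < 4 * Real.exp 1 * C₀ := by positivity
    have h3 : ∑' j, ‖V j‖ = 0 :=
      le_antisymm (nonpos_of_mul_nonpos_right h1 h2) (tsum_nonneg fun j => norm_nonneg _)
    have h4 : ∀ j, V j = 0 := fun j => by
      have := (hasSum_zero_iff_of_nonneg fun j => norm_nonneg (V j)).1 (h3 ▸ hsum.hasSum)
      exact norm_eq_zero.1 (congrFun this j)
    have h5 : W = 0 := by
      rw [← hV.tsum_eq]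
      simp [h4]
    rw [h5, add_zero]
    exact schmidtRank_exp_decoupledHamiltonian_le HA HB z

/-- One step of the evolution, `exp (x H) = exp (x H₀) * F`, with `F` replaced by its truncation.
The error is expressed as a relative error `E`. -/
theorem exists_relative_error (HA : Matrix a a ℂ) (HB : Matrix b b ℂ)
    {W : Matrix (a × b) (a × b) ℂ}
    {V : ℕ → Matrix (a × b) (a × b) ℂ} (hsum : Summable fun j => ‖V j‖) (hV : HasSum V W)
    {D₀ : ℕ} (hD₀ : 1 ≤ D₀) (hrank : ∀ j, schmidtRank (V j) ≤ D₀)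
    {C₀ κ : ℝ} (hC₀ : 1 ≤ C₀) (hκ : 0 < κ)
    (htail : ∀ D : ℕ, ∑' j, ‖V (D + j)‖ ≤ C₀ * (∑' j, ‖V j‖) * ((D : ℝ) + 1) ^ (-κ))
    {Q : ℝ} (hQ : 0 ≤ Q)
    (had : ∀ j s : ℕ,
      1 / (s.factorial : ℝ) *
        ‖iteratedCommutator (decoupledHamiltonian HA HB) s (V j)‖ ≤ Q ^ s * ‖V j‖)
    {x : ℂ} (hx : ‖x‖ * rateQ0 Q C₀ (∑' j, ‖V j‖) ≤ 1) {N : ℝ} (hN : 2 ≤ N) {c : ℝ}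
    (hc : ‖NormedSpace.exp ((-x) • (decoupledHamiltonian HA HB + W)) *
      NormedSpace.exp (x • decoupledHamiltonian HA HB)‖ ≤ c) :
    ∃ E : Matrix (a × b) (a × b) ℂ, ‖E‖ ≤ c * (4 / N) ∧ ∀ m : ℕ,
      (schmidtRank ((NormedSpace.exp (x • (decoupledHamiltonian HA HB + W)) * (1 + E)) ^ m) : ℝ) ≤
        N ^ ((6 + 4 / κ + Real.logb 2 D₀) * m) := by
  obtain ⟨F, hF, hFr⟩ := exists_truncated_propagator HA HB hsum hV hD₀ hrank hC₀ hκ htail hQ had hx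
    hN
  set H₀ := decoupledHamiltonian HA HB with hH₀
  set P := NormedSpace.exp (x • (-H₀)) * NormedSpace.exp (x • (H₀ + W)) with hP
  set R := NormedSpace.exp ((-x) • (H₀ + W)) * NormedSpace.exp (x • H₀) with hR
  refine ⟨R * (F - P), (norm_mul_le _ _).trans
    (mul_le_mul hc hF (norm_nonneg _) ((norm_nonneg _).trans hc)), fun m => ?_⟩
  have h1 : NormedSpace.exp (x • (H₀ + W)) * R = NormedSpace.exp (x • H₀) := by
    rw [hR, ← mul_assoc, exp_smul_mul_exp_neg_smul, one_mul]
  have h2 : NormedSpace.exp (x • H₀) * P = NormedSpace.exp (x • (H₀ + W)) := by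
    rw [hP, smul_neg, ← neg_smul, ← mul_assoc, exp_smul_mul_exp_neg_smul, one_mul]
  have h3 : NormedSpace.exp (x • (H₀ + W)) * (1 + R * (F - P)) = NormedSpace.exp (x • H₀) * F := by
    rw [mul_add, mul_one, ← mul_assoc, h1, mul_sub, h2, add_sub_cancel]
  have h4 : schmidtRank (NormedSpace.exp (x • H₀) * F) ≤ schmidtRank F :=
    (schmidtRank_mul_le _ _).trans (by
      simpa using Nat.mul_le_mul_right (schmidtRank F)
        (schmidtRank_exp_decoupledHamiltonian_le HA HB x))
  rw [h3, Real.rpow_mul_natCast (by linarith)]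
  calc (schmidtRank ((NormedSpace.exp (x • H₀) * F) ^ m) : ℝ)
      ≤ (schmidtRank F : ℝ) ^ m := by
        exact_mod_cast (schmidtRank_pow_le _ _).trans (Nat.pow_le_pow_left h4 m)
    _ ≤ _ := pow_le_pow_left₀ (Nat.cast_nonneg _) hFr m

end Steps

theorem mainTheorem5 {a b : Type*} [Fintype a] [DecidableEq a] [Fintype b] [DecidableEq b]
    -- the Hamiltonian `H = H_A ⊗ 1 + 1 ⊗ H_B + V_AB`
    (HA : Matrix a a ℂ) (HB : Matrix b b ℂ) (VAB : Matrix (a × b) (a × b) ℂ)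
    (hHA : HA.IsHermitian) (hHB : HB.IsHermitian) (hVAB : VAB.IsHermitian)
    -- the decomposition of `V_AB`; `V j` is the `(j+1)`-st term of the series
    (V : ℕ → Matrix (a × b) (a × b) ℂ) (hsum : Summable fun j => ‖V j‖) (hV : HasSum V VAB)
    (D₀ : ℕ) (hD₀ : 1 ≤ D₀) (hrank : ∀ j, schmidtRank (V j) ≤ D₀)
    -- the decay of the tails
    (C₀ κ : ℝ) (hC₀ : 1 ≤ C₀) (hκ : 0 < κ)
    (htail : ∀ D : ℕ, ∑' j, ‖V (D + j)‖ ≤ C₀ * (∑' j, ‖V j‖) * ((D : ℝ) + 1) ^ (-κ))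
    -- the bound on iterated commutators with `H₀`
    (Q : ℝ) (hQ : 0 ≤ Q)
    (had : ∀ j s : ℕ,
      1 / (s.factorial : ℝ) *
          ‖iteratedCommutator (decoupledHamiltonian HA HB) s (V j)‖ ≤ Q ^ s * ‖V j‖)
    (ε₀ : ℝ) (hε₀ : 0 < ε₀) :
    (∀ t : ℝ, 0 ≤ t →
      ∃ U : Matrix (a × b) (a × b) ℂ,
        ‖NormedSpace.exp ((-(Complex.I * t)) • (decoupledHamiltonian HA HB + VAB)) - U‖ ≤ ε₀ ∧
        (schmidtRank U : ℝ) ≤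
          (8 * (⌈t * rateQ0 Q C₀ (∑' j, ‖V j‖)⌉₊ : ℝ) / ε₀) ^
            ((6 + 4 / κ + Real.logb 2 D₀) * (⌈t * rateQ0 Q C₀ (∑' j, ‖V j‖)⌉₊ : ℝ))) ∧
    (∀ β : ℝ, 0 ≤ β →
      ∃ ρ : Matrix (a × b) (a × b) ℂ,
        (∀ p : ℝ≥0∞, 1 ≤ p →
          schattenNorm p (NormedSpace.exp ((β : ℂ) • (decoupledHamiltonian HA HB + VAB)) - ρ) ≤
            ε₀ * schattenNorm p
              (NormedSpace.exp ((β : ℂ) • (decoupledHamiltonian HA HB + VAB)))) ∧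
        (schmidtRank ρ : ℝ) ≤
          (48 * (⌈β * rateQ0 Q C₀ (∑' j, ‖V j‖)⌉₊ : ℝ) / ε₀) ^
            (2 * (6 + 4 / κ + Real.logb 2 D₀) *
              (⌈β * rateQ0 Q C₀ (∑' j, ‖V j‖)⌉₊ : ℝ))) := by
  set g := ∑' j, ‖V j‖ with hg
  set H₀ := decoupledHamiltonian HA HB with hH₀
  have hH : (H₀ + VAB).IsHermitian := (isHermitian_decoupledHamiltonian hHA hHB).add hVAB
  have hexp : 0 ≤ 6 + 4 / κ + Real.logb 2 D₀ := by
    have h1 : 0 ≤ Real.logb 2 D₀ := Real.logb_nonneg one_lt_two (by exact_mod_cast hD₀)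
    positivity
  refine ⟨fun t ht => ?_, fun β hβ => ?_⟩
  · set n := ⌈t * rateQ0 Q C₀ g⌉₊ with hn
    have hnorm : ‖-(Complex.I * t)‖ = t := by
      simp [abs_of_nonneg ht]
    have hre : (-(Complex.I * t)).re = 0 := by simp
    rcases le_or_gt 1 ε₀ with hε | hε
    · refine ⟨0, ?_, ?_⟩
      · rw [sub_zero]
        exact (norm_exp_smul_le_one hH hre).trans hε
      · rw [schmidtRank_zero, Nat.cast_zero]
        positivity
    rcases Nat.eq_zero_or_pos n with h0 | hpos
    · refine ⟨NormedSpace.exp ((-(Complex.I * t)) • (H₀ + VAB)), by simpa using hε₀.le, ?_⟩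
      rw [h0]
      simp only [Nat.cast_zero, mul_zero, Real.rpow_zero]
      have h1 : t * rateQ0 Q C₀ g ≤ 0 := Nat.ceil_eq_zero.1 h0
      exact_mod_cast schmidtRank_exp_le_one_of_rate hsum hV hC₀ hQ (by rwa [hnorm])
    · have hn1 : (1 : ℝ) ≤ n := by exact_mod_cast hpos
      set x : ℂ := -(Complex.I * t) / n with hx
      have hx1 : ‖x‖ * rateQ0 Q C₀ g ≤ 1 := by
        rw [hx, norm_div, hnorm, Complex.norm_natCast, div_mul_eq_mul_div,
          div_le_one (by linarith)]
        exact Nat.le_ceil _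
      have hxre : x.re = 0 := by
        rw [hx, Complex.div_natCast_re, hre, zero_div]
      have hN : 2 ≤ 8 * (n : ℝ) / ε₀ := by
        rw [le_div_iff₀ hε₀]
        nlinarith
      have hc : ‖NormedSpace.exp ((-x) • (H₀ + VAB)) * NormedSpace.exp (x • H₀)‖ ≤ 1 :=
        (norm_mul_le _ _).trans (mul_le_one₀ (norm_exp_smul_le_one hH (by simp [hxre]))
          (norm_nonneg _) (norm_exp_smul_le_one (isHermitian_decoupledHamiltonian hHA hHB) hxre))
      obtain ⟨E, hE, hrk⟩ := exists_relative_error HA HB hsum hV hD₀ hrank hC₀ hκ htail hQ had hx1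
        hN hc
      refine ⟨(NormedSpace.exp (x • (H₀ + VAB)) * (1 + E)) ^ n, ?_, hrk n⟩
      rw [← exp_smul_pow (H₀ + VAB) _ hpos.ne', norm_sub_rev]
      refine (norm_pow_sub_pow_le (norm_exp_smul_le_one hH hxre) hE n).trans
        (one_add_pow_sub_one_le (by positivity) hε₀.le hε.le (le_of_eq ?_))
      field_simp
      norm_num
  · set n := ⌈β * rateQ0 Q C₀ g⌉₊ with hn
    have hnorm : ‖(β : ℂ)‖ = β := by
      simp [abs_of_nonneg hβ]
    rcases le_or_gt 1 ε₀ with hε | hε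
    · refine ⟨0, fun p hp => ?_, ?_⟩
      · rw [sub_zero]
        exact le_mul_of_one_le_left (schattenNorm_nonneg hp _) hε
      · rw [schmidtRank_zero, Nat.cast_zero]
        positivity
    rcases Nat.eq_zero_or_pos n with h0 | hpos
    · refine ⟨NormedSpace.exp ((β : ℂ) • (H₀ + VAB)), fun p hp => ?_, ?_⟩
      · rw [sub_self, schattenNorm_zero hp]
        exact mul_nonneg hε₀.le (schattenNorm_nonneg hp _)
      · rw [h0]
        simp only [Nat.cast_zero, mul_zero, Real.rpow_zero]
        have h1 : β * rateQ0 Q C₀ g ≤ 0 := Nat.ceil_eq_zero.1 h0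
        have h2 : ‖(β : ℂ)‖ * rateQ0 Q C₀ g ≤ 0 := by rwa [hnorm]
        exact_mod_cast schmidtRank_exp_le_one_of_rate hsum hV hC₀ hQ h2
    · have hn1 : (1 : ℝ) ≤ n := by exact_mod_cast hpos
      set x : ℝ := β / n with hx
      have hx1 : ‖(x : ℂ)‖ * rateQ0 Q C₀ g ≤ 1 := by
        rw [hx, Complex.norm_real, Real.norm_of_nonneg (by positivity), div_mul_eq_mul_div,
          div_le_one (by linarith)]
        exact Nat.le_ceil _
      have hN : 2 ≤ 48 * (n : ℝ) / ε₀ := by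
        rw [le_div_iff₀ hε₀]
        nlinarith
      -- the inverse propagator is the adjoint of the propagator at time `-x`
      have hc : ‖NormedSpace.exp ((-(x : ℂ)) • (H₀ + VAB)) * NormedSpace.exp ((x : ℂ) • H₀)‖
          ≤ 4 := by
        have h1 := norm_exp_neg_mul_exp_le (x := -(x : ℂ)) hsum hV hC₀ hκ htail hQ had
          (by rwa [norm_neg])
        rw [← norm_star, star_mul, star_exp_smul hH,
          star_exp_smul (isHermitian_decoupledHamiltonian hHA hHB)]
        rw [smul_neg, neg_smul, neg_neg] at h1
        simpa using h1
      obtain ⟨E, hE, hrk⟩ := exists_relative_error HA HB hsum hV hD₀ hrank hC₀ hκ htail hQ had hx1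
        hN hc
      obtain ⟨U, hU, d, hd, hK⟩ := exists_unitary_exp_eq hH x
      have hpow : NormedSpace.exp ((x : ℂ) • (H₀ + VAB)) ^ n =
          NormedSpace.exp ((β : ℂ) • (H₀ + VAB)) := by
        rw [← exp_smul_pow (H₀ + VAB) (β : ℂ) hpos.ne', hx]
        push_cast
        rfl
      refine ⟨(NormedSpace.exp ((x : ℂ) • (H₀ + VAB)) * (1 + E)) ^ n, fun p hp => ?_, ?_⟩
      · rw [← hpow, ← schattenNorm_neg, neg_sub]
        refine (schattenNorm_pow_sub_pow_le hU hd hpos hK hE hp).trans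
          (mul_le_mul_of_nonneg_right ?_ (schattenNorm_nonneg hp _))
        refine one_add_pow_sub_one_le (by positivity) hε₀.le hε.le ?_
        have h2 : (n : ℝ) * (4 * (4 / (48 * n / ε₀))) = ε₀ / 3 := by
          field_simp
          norm_num
        rw [h2]
        linarith
      · refine (hrk n).trans (Real.rpow_le_rpow_of_exponent_le (by linarith) ?_)
        have h3 : 0 ≤ (6 + 4 / κ + Real.logb 2 D₀) * n := by positivity
        linarith
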